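/- Let $(\Omega,\mathcal F,(\mathcal F_t)_{t\ge 0},P)$ be a filtered probability space carrying a Poisson random measure $\mu$ on $\mathbb R_+\times\mathbb R$ with intensity $m=dt\otimes dx$. That is, $\mu$ is a measurable family of measures $\mu(\omega,\cdot)$ with values in $\mathbb N\cup\{\infty\}$ such that $\mu(\omega,\{t\}\times\mathbb R)\le 1$ for all $\omega,t$; $\mathbf E[\mu(A)]=m(A)$ for all Borel $A$; and, for every $t$ and all pairwise disjoint Borel sets $A_1,\dots,A_l\subset\,]t,\infty[\,\times\mathbb R$ of finite intensity, the random variables $\mu(A_1),\dots,\mu(A_l)$ are mutually independent and the vector $(\mu(A_1),\dots,\mu(A_l))$ is independent of $\mathcal F_t$. Let $H,C$ be complex $2\times 2$ matrices with $H=H^\star$, and put $\mathcal J(\rho)=C\rho C^\star$ and $L(\rho)=-i[H,\rho]-\frac12\{C^\star C,\rho\}+C\rho C^\star$. A state is a positive semidefinite $2\times2$ matrix of trace one. Let $\rho_0$ be any state. A solution is a process $(\rho_t)_{t\ge0}$ of complex $2\times2$ matrices which almost surely is c\`adl\`ag and satisfies, for all $t\ge 0$, with absolutely convergent integrals, $$\rho_t=\rho_0+\int_0^t\Big[L(\rho_{s-})+\mathrm{Tr}[\mathcal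 J(\rho_{s-})]\,\rho_{s-}-\mathcal J(\rho_{s-})\Big]ds+\int_{]0,t]}\int_{\mathbb R_+}\Big[\frac{\mathcal J(\rho_{s-})}{\mathrm{Tr}[\mathcal J(\rho_{s-})]}-\rho_{s-}\Big]\mathbf 1_{0\le x\le \mathrm{Tr}[\mathcal J(\rho_{s-})]}\,\mu(ds,dx),$$ where, for matrices that are not states, the real part of the trace is used in the indicator. Then there exists a solution $(\rho_t)$ defined for all times $t\ge0$, and it is unique up to indistinguishability among all matrix-valued solutions. It can be chosen with values in the set of states; almost surely, for all $t$, the number $\mu\{(s,x): 0<s\le t,\ 0\le x\le \mathrm{Tr}[\mathcal J(\rho_{s-})]\}$ of its jump times up to $t$, counted with the points of $\mu$, is finite; and, if the restriction of $\mu$ to $[0,t]\times\mathbb R$ is $\mathcal F_t$-measurable for every $t$, then $(\rho_t)$ is adapted to $(\mathcal F_t)$. -/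

import Mathlib

open MeasureTheory ProbabilityTheory Set Filter Topology
open scoped NNReal ENNReal Matrix ComplexOrder

namespace JumpBelavkin

/-- Complex `2 × 2` matrices, i.e. operators on `ℂ²`. -/
abbrev Mat : Type := Matrix (Fin 2) (Fin 2) ℂ

/-- A state on `ℂ²`: a positive operator of trace one. -/
def IsState (ρ : Mat) : Prop := ρ.PosSemidef ∧ ρ.trace = 1

/-- The operator `𝓙(ρ) = C ρ C⋆`. -/
def jumpOp (C ρ : Mat) : Mat := C * ρ * Cᴴ

/-- The Lindbladian `L(ρ) = -i[H, ρ] - ½ {C⋆C, ρ} + C ρ C⋆`. -/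
noncomputable def lindblad (H C ρ : Mat) : Mat :=
  -(Complex.I • (H * ρ - ρ * H)) - (1 / 2 : ℂ) • (Cᴴ * C * ρ + ρ * (Cᴴ * C)) + C * ρ * Cᴴ

/-- The drift `L(ρ) + Tr[𝓙(ρ)] ρ - 𝓙(ρ)`. -/
noncomputable def drift (H C ρ : Mat) : Mat :=
  lindblad H C ρ + (jumpOp C ρ).trace • ρ - jumpOp C ρ

/-- The region `0 ≤ x ≤ Tr[𝓙(ρ)]`.  On states the trace is a nonnegative real number; on an
arbitrary matrix the real part of the trace is used. -/
def inJumpRegion (C ρ : Mat) (x : ℝ) : Prop := 0 ≤ x ∧ x ≤ ((jumpOp C ρ).trace).re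

/-- The jump coefficient `(𝓙(ρ) / Tr[𝓙(ρ)] - ρ) 1_{0 ≤ x ≤ Tr[𝓙(ρ)]}`. -/
noncomputable def jumpCoeff (C ρ : Mat) (x : ℝ) : Mat :=
  {y : ℝ | inJumpRegion C ρ y}.indicator
    (fun _ => ((jumpOp C ρ).trace)⁻¹ • jumpOp C ρ - ρ) x

/-- Right-continuous paths with left limits on `[0, ∞)`. -/
def IsCadlag (r : ℝ≥0 → Mat) : Prop :=
  ∀ t, ContinuousWithinAt r (Ici t) t ∧ ∃ l, Tendsto r (𝓝[<] t) (𝓝 l)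

/-- Lebesgue measure `dt` on `ℝ₊ = [0, ∞)`. -/
noncomputable def timeMeasure : Measure ℝ≥0 :=
  (volume : Measure ℝ).comap ((↑) : ℝ≥0 → ℝ)

section RandomMeasure

variable {Ω : Type*} [mΩ : MeasurableSpace Ω]

/-- An integer valued random measure on `ℝ₊ × ℝ`. -/
structure IsIntegerValued (μ : Kernel Ω (ℝ≥0 × ℝ)) : Prop where
  slice_le_one : ∀ ω (t : ℝ≥0), μ ω ({t} ×ˢ univ) ≤ 1
  integer : ∀ ω (A : Set (ℝ≥0 × ℝ)), MeasurableSet A → ∃ n : ℕ∞, μ ω A = (n : ℝ≥0∞)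

/-- `μ` is a Poisson random measure on `ℝ₊ × ℝ` with intensity measure `m`, on the filtered
probability space `(Ω, 𝓕, P)`. -/
structure IsPoissonRandomMeasure (𝓕 : Filtration ℝ≥0 mΩ) (P : Measure Ω)
    (m : Measure (ℝ≥0 × ℝ)) (μ : Kernel Ω (ℝ≥0 × ℝ)) : Prop where
  integerValued : IsIntegerValued μ
  intensity : ∀ A : Set (ℝ≥0 × ℝ), MeasurableSet A → ∫⁻ ω, μ ω A ∂P = m A
  nonatomic : ∀ p, m {p} = 0
  zero_slice : m ({0} ×ˢ univ) = 0
  indep : ∀ (t : ℝ≥0) (l : ℕ) (A : Fin l → Set (ℝ≥0 × ℝ)),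
    (∀ i, MeasurableSet (A i)) → (∀ i, A i ⊆ Ioi t ×ˢ univ) →
    Pairwise (fun i j => Disjoint (A i) (A j)) → (∀ i, m (A i) < ∞) →
      iIndepFun (fun i ω => μ ω (A i)) P ∧
      Indep (MeasurableSpace.comap (fun ω i => μ ω (A i)) inferInstance) (𝓕 t) P

/-- The random measure `μ` is adapted: its restriction to `[0, t] × ℝ` is `𝓕 t`-measurable. -/
def IsAdaptedMeasure (𝓕 : Filtration ℝ≥0 mΩ) (μ : Kernel Ω (ℝ≥0 × ℝ)) : Prop :=
  ∀ (t : ℝ≥0) (A : Set (ℝ≥0 × ℝ)), MeasurableSet A → A ⊆ Iic t ×ˢ univ →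
    Measurable[𝓕 t] (fun ω => μ ω A)

/-- The path `r` solves, for all times, the equation driven by the measure `ν` on `ℝ₊ × ℝ`:
`r_t = ρ₀ + ∫_{(0,t]} drift(r_{s-}) ds + ∫_{(0,t] × ℝ₊} jumpCoeff(r_{s-}, x) ν(ds, dx)`,
where the integrals of matrices are taken entry by entry and are required to converge absolutely. -/
def SolvesPath (H C ρ₀ : Mat) (ν : Measure (ℝ≥0 × ℝ)) (r : ℝ≥0 → Mat) : Prop :=
  ∀ (t : ℝ≥0) (i j : Fin 2),
    IntegrableOn (fun s => drift H C (Function.leftLim r s) i j) (Ioc 0 t) timeMeasure ∧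
    IntegrableOn (fun p : ℝ≥0 × ℝ => jumpCoeff C (Function.leftLim r p.1) p.2 i j)
      (Ioc 0 t ×ˢ Ici 0) ν ∧
    r t i j = ρ₀ i j + ∫ s in Ioc 0 t, drift H C (Function.leftLim r s) i j ∂timeMeasure
      + ∫ p in Ioc 0 t ×ˢ Ici 0, jumpCoeff C (Function.leftLim r p.1) p.2 i j ∂ν

/-- The matrix-valued process `ρ` is a solution of the jump-Belavkin equation driven by `μ` and
started at `ρ₀`: almost surely its path is càdlàg and satisfies the equation for all times. -/
structure IsSolution (P : Measure Ω) (μ : Kernel Ω (ℝ≥0 × ℝ)) (H C ρ₀ : Mat)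
    (ρ : ℝ≥0 → Ω → Mat) : Prop where
  measurable : ∀ t, StronglyMeasurable (ρ t)
  cadlag : ∀ᵐ ω ∂P, IsCadlag (fun t => ρ t ω)
  equation : ∀ᵐ ω ∂P, SolvesPath H C ρ₀ (μ ω) (fun t => ρ t ω)

/-- The number of jumps up to time `t`: the number of points of `ν` in `(0, t] × ℝ` which lie
in the region `0 ≤ x ≤ Tr[𝓙(r_{s-})]`. -/
noncomputable def jumpCount (C : Mat) (ν : Measure (ℝ≥0 × ℝ)) (r : ℝ≥0 → Mat) (t : ℝ≥0) :
    ℝ≥0∞ :=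
  ν {p | p.1 ∈ Ioc 0 t ∧ inJumpRegion C (Function.leftLim r p.1) p.2}

end RandomMeasure

end JumpBelavkin

namespace JumpBelavkin

section

open scoped MatrixOrder

/-! The problem is pathwise. The intensity gives every box `Ioc 0 t ×ˢ Icc 0 k` finite mean mass, so
almost every configuration has finitely many points in each box, and none with mark zero. On states
the jump rate is at most a constant K (`exists_jump_rate_bound`), so only points with mark in (0, K]
can act, finitely many up to any time.

Existence: with G = -iH - ½C⋆C the drift is Gρ + ρG⋆ + Tr[𝓙(ρ)]ρ, and normalising exp(aG) Z exp(aG)⋆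
solves the jump-free equation for all time within the states (`hasDerivAt_flow`). A jump with
positive mark maps states to states. Finite configurations are handled by induction, adding the last
point (`IsStatePath.add_dirac`). Removing the last point is a measurable operation on
configurations, which yields measurability and adaptedness.

Uniqueness (`eq_of_solvesAt`): a competitor need not consist of states, but the drift is locally
Lipschitz and the rate locally bounded. At the infimum s of the disagreement times the paths still
agree, because the equation at s sees only left limits. Just after s no point has a small enough
mark to act, and a contraction estimate forces agreement. The same theorem glues the solutions built
for different time horizons. -/

lemma exists_conjTranspose_mul_self {A : Mat} (hA : A.PosSemidef) : ∃ B : Mat, A = Bᴴ * B := by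
  refine ⟨CFC.sqrt A, ?_⟩
  have h0 : 0 ≤ CFC.sqrt A := CFC.sqrt_nonneg A
  have h : (CFC.sqrt A)ᴴ = CFC.sqrt A := (Matrix.nonneg_iff_posSemidef.1 h0).isHermitian
  rw [h, CFC.sqrt_mul_sqrt_self A hA.nonneg]

end

/-! ### The jump-free evolution and bounds on states. -/

section Flow

open scoped Matrix.Norms.Operator

/-- The effective non-selfadjoint Hamiltonian part `-iH - ½ C⋆C`. -/
noncomputable def effGen (H C : Mat) : Mat := -(Complex.I • H) - (1 / 2 : ℂ) • (Cᴴ * C)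

/-- The unnormalised evolution without jumps. -/
noncomputable def linFlow (H C : Mat) (a : ℝ) (Z : Mat) : Mat :=
  NormedSpace.exp (a • effGen H C) * Z * (NormedSpace.exp (a • effGen H C))ᴴ

/-- The normalised evolution without jumps. -/
noncomputable def flow (H C : Mat) (a : ℝ) (Z : Mat) : Mat :=
  ((linFlow H C a Z).trace)⁻¹ • linFlow H C a Z

lemma conjTranspose_effGen {H : Mat} (hH : H.IsHermitian) (C : Mat) :
    (effGen H C)ᴴ = Complex.I • H - (1 / 2 : ℂ) • (Cᴴ * C) := by
  have : Hᴴ = H := hH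
  simp [effGen, Matrix.conjTranspose_smul, Matrix.conjTranspose_mul, this]

/-- The term CρC⋆ of the Lindbladian cancels against -𝓙(ρ). Up to a scalar multiple of ρ the drift
is then linear and generates a conjugation. -/
lemma drift_eq_effGen {H : Mat} (hH : H.IsHermitian) (C ρ : Mat) :
    drift H C ρ = effGen H C * ρ + ρ * (effGen H C)ᴴ + (jumpOp C ρ).trace • ρ := by
  rw [conjTranspose_effGen hH]
  simp only [drift, lindblad, effGen, jumpOp, sub_mul, mul_sub, neg_mul, smul_mul_assoc,
    mul_smul_comm, smul_add, smul_sub]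
  abel

lemma linFlow_posSemidef (H C : Mat) (a : ℝ) {Z : Mat} (hZ : IsState Z) :
    (linFlow H C a Z).PosSemidef :=
  hZ.1.mul_mul_conjTranspose_same _

lemma linFlow_trace_ne_zero (H C : Mat) (a : ℝ) {Z : Mat} (hZ : IsState Z) :
    (linFlow H C a Z).trace ≠ 0 := by
  intro h
  have h0 := (linFlow_posSemidef H C a hZ).trace_eq_zero_iff.1 h
  have hu : IsUnit (NormedSpace.exp (a • effGen H C)) := Matrix.isUnit_exp _
  have hu' : IsUnit (NormedSpace.exp (a • effGen H C))ᴴ := hu.star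
  rw [linFlow, hu'.mul_left_eq_zero, hu.mul_right_eq_zero] at h0
  have := hZ.2
  simp [h0] at this

lemma isState_inv_trace_smul {A : Mat} (hA : A.PosSemidef) (h : A.trace ≠ 0) :
    IsState (A.trace⁻¹ • A) := by
  refine ⟨hA.smul ?_, by simp [Matrix.trace_smul, h]⟩
  exact inv_nonneg.2 hA.trace_nonneg

lemma IsState.flow (H C : Mat) (a : ℝ) {Z : Mat} (hZ : IsState Z) : IsState (flow H C a Z) :=
  isState_inv_trace_smul (linFlow_posSemidef H C a hZ) (linFlow_trace_ne_zero H C a hZ)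

lemma flow_zero (H C : Mat) {Z : Mat} (hZ : IsState Z) : flow H C 0 Z = Z := by
  simp [JumpBelavkin.flow, linFlow, hZ.2]

lemma hasDerivAt_linFlow (H C : Mat) (Z : Mat) (a : ℝ) :
    HasDerivAt (fun u : ℝ => linFlow H C u Z)
      (effGen H C * linFlow H C a Z + linFlow H C a Z * (effGen H C)ᴴ) a := by
  have h1 : HasDerivAt (fun u : ℝ => NormedSpace.exp (u • effGen H C))
      (effGen H C * NormedSpace.exp (a • effGen H C)) a :=
    hasDerivAt_exp_smul_const' (effGen H C) a
  have h2 : HasDerivAt (fun u : ℝ => NormedSpace.exp (u • (effGen H C)ᴴ))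
      (NormedSpace.exp (a • (effGen H C)ᴴ) * (effGen H C)ᴴ) a :=
    hasDerivAt_exp_smul_const ((effGen H C)ᴴ) a
  have e : ∀ u : ℝ, (NormedSpace.exp (u • effGen H C))ᴴ = NormedSpace.exp (u • (effGen H C)ᴴ) := by
    intro u
    rw [← Matrix.exp_conjTranspose, Matrix.conjTranspose_smul]
    simp
  have h3 := (h1.mul_const Z).mul h2
  simp only [linFlow, e]
  refine h3.congr_deriv ?_
  simp only [mul_assoc]

/-- Differentiating the inverse trace produces exactly the scalar term of the drift. -/
lemma hasDerivAt_flow {H : Mat} (hH : H.IsHermitian) (C : Mat) {Z : Mat} (hZ : IsState Z) (a : ℝ) :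
    HasDerivAt (fun u : ℝ => flow H C u Z) (drift H C (flow H C a Z)) a := by
  have h1 := hasDerivAt_linFlow H C Z a
  have hT : HasDerivAt (fun u : ℝ => (linFlow H C u Z).trace)
      ((effGen H C * linFlow H C a Z + linFlow H C a Z * (effGen H C)ᴴ).trace) a :=
    ((Matrix.traceLinearMap (Fin 2) ℝ ℂ).toContinuousLinearMap.hasFDerivAt).comp_hasDerivAt a h1
  have hne := linFlow_trace_ne_zero H C a hZ
  have h2 := (hT.inv hne).smul h1
  refine h2.congr_deriv ?_
  simp only [Pi.inv_apply]
  set σ := linFlow H C a Z with hσ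
  -- Cyclicity of the trace, with G + G⋆ = -C⋆C.
  have htr : (effGen H C * σ + σ * (effGen H C)ᴴ).trace = -(jumpOp C σ).trace := by
    rw [conjTranspose_effGen hH, Matrix.trace_add, Matrix.trace_mul_comm σ, ← Matrix.trace_add,
      ← add_mul, effGen, jumpOp, mul_assoc, Matrix.trace_mul_comm C, mul_assoc,
      Matrix.trace_mul_comm σ, ← Matrix.trace_neg, ← neg_mul]
    congr 2
    module
  rw [htr, drift_eq_effGen hH, JumpBelavkin.flow, ← hσ]
  have hj : jumpOp C ((σ.trace)⁻¹ • σ) = (σ.trace)⁻¹ • jumpOp C σ := by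
    simp [jumpOp]
  rw [hj, Matrix.trace_smul]
  simp only [mul_smul_comm, smul_mul_assoc, smul_add, smul_eq_mul, smul_smul]
  congr 2
  field_simp

lemma continuous_flow {H : Mat} (hH : H.IsHermitian) (C : Mat) {Z : Mat} (hZ : IsState Z) :
    Continuous (fun u : ℝ => flow H C u Z) :=
  continuous_iff_continuousAt.2 fun a => (hasDerivAt_flow hH C hZ a).continuousAt

lemma hasDerivAt_flow_apply {H : Mat} (hH : H.IsHermitian) (C : Mat) {Z : Mat} (hZ : IsState Z)
    (a : ℝ) (i j : Fin 2) :
    HasDerivAt (fun u : ℝ => flow H C u Z i j) (drift H C (flow H C a Z) i j) a :=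
  ((Matrix.entryLinearMap ℝ ℂ i j).toContinuousLinearMap.hasFDerivAt).comp_hasDerivAt a
    (hasDerivAt_flow hH C hZ a)

lemma contDiff_drift (H C : Mat) : ContDiff ℝ 1 (drift H C) := by
  have ht : ContDiff ℝ 1 (fun ρ : Mat => ρ.trace) :=
    (Matrix.traceLinearMap (Fin 2) ℝ ℂ).toContinuousLinearMap.contDiff
  have hJ : ContDiff ℝ 1 (jumpOp C) := by unfold jumpOp; fun_prop
  have hL : ContDiff ℝ 1 (lindblad H C) := by unfold lindblad; fun_prop
  exact (hL.add ((ht.comp hJ).smul contDiff_id)).sub hJ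

lemma continuous_drift (H C : Mat) : Continuous (drift H C) := (contDiff_drift H C).continuous

lemma continuous_trace_jumpOp (C : Mat) : Continuous (fun ρ => ((jumpOp C ρ).trace).re) := by
  unfold jumpOp; fun_prop

/-- The drift is quadratic, so the Lipschitz bound is only local. It is needed around arbitrary
matrices, since competing solutions may leave the states. -/
lemma exists_lipschitz_drift (H C Z : Mat) : ∃ L : ℝ, 0 ≤ L ∧ ∃ ε > 0, ∀ a b : Mat,
    a ∈ Metric.closedBall Z ε → b ∈ Metric.closedBall Z ε →
      ‖drift H C a - drift H C b‖ ≤ L * ‖a - b‖ := by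
  obtain ⟨L, s, hs, hL⟩ := (contDiff_drift H C).contDiffAt (x := Z).exists_lipschitzOnWith
  obtain ⟨ε, hε, hsub⟩ := Metric.nhds_basis_closedBall.mem_iff.1 hs
  exact ⟨L, L.2, ε, hε, fun a b ha hb => by
    simpa [dist_eq_norm] using hL.dist_le_mul a (hsub ha) b (hsub hb)⟩

lemma norm_apply_le (A : Mat) (i j : Fin 2) : ‖A i j‖ ≤ ‖A‖ := by
  rw [Matrix.linfty_opNorm_def]
  have h1 : ‖A i j‖₊ ≤ ∑ k, ‖A i k‖₊ :=
    Finset.single_le_sum (f := fun k => ‖A i k‖₊) (fun _ _ => zero_le) (Finset.mem_univ j)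
  have h2 := Finset.le_sup (f := fun i => ∑ k, ‖A i k‖₊) (Finset.mem_univ i)
  exact_mod_cast h1.trans h2

lemma norm_le_of_apply_le (A : Mat) (c : ℝ) (hc : 0 ≤ c) (h : ∀ i j, ‖A i j‖ ≤ c) :
    ‖A‖ ≤ 2 * c := by
  lift c to ℝ≥0 using hc
  rw [Matrix.linfty_opNorm_def]
  have : (Finset.univ.sup fun i => ∑ k, ‖A i k‖₊) ≤ 2 * c := by
    refine Finset.sup_le fun i _ => ?_
    rw [Fin.sum_univ_two, two_mul]
    exact add_le_add (by exact_mod_cast h i 0) (by exact_mod_cast h i 1)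
  exact_mod_cast this

/-- Write ρ = B⋆B. Trace one says that the squared moduli of the entries of B sum to 1, so each
entry of ρ is a sum of two products of modulus at most 1. -/
lemma IsState.norm_apply_le_two {ρ : Mat} (hρ : IsState ρ) (i j : Fin 2) : ‖ρ i j‖ ≤ 2 := by
  obtain ⟨B, rfl⟩ := exists_conjTranspose_mul_self hρ.1
  have htr := congrArg Complex.re hρ.2
  have hsq : ∀ z : ℂ, (starRingEnd ℂ z * z).re = ‖z‖ ^ 2 := by
    intro z
    rw [mul_comm, Complex.mul_conj, Complex.normSq_eq_norm_sq]; norm_cast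
  simp only [Matrix.trace, Matrix.diag, Matrix.mul_apply, Matrix.conjTranspose_apply,
    Fin.sum_univ_two, RCLike.star_def, Complex.add_re, hsq, Complex.one_re] at htr
  have hb : ∀ i j, ‖B i j‖ ≤ 1 := by
    intro i j
    rw [← sq_le_one_iff₀ (norm_nonneg _)]
    fin_cases i <;> fin_cases j <;> simp <;>
      nlinarith [sq_nonneg ‖B 0 0‖, sq_nonneg ‖B 0 1‖, sq_nonneg ‖B 1 0‖, sq_nonneg ‖B 1 1‖]
  rw [Matrix.mul_apply, Fin.sum_univ_two]
  have h2 : ∀ k, ‖Bᴴ i k * B k j‖ ≤ 1 := fun k => by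
    rw [norm_mul, Matrix.conjTranspose_apply, norm_star]
    exact mul_le_one₀ (hb _ _) (norm_nonneg _) (hb _ _)
  exact (norm_add_le _ _).trans (by linarith [h2 0, h2 1])

lemma exists_jump_rate_bound (C : Mat) :
    ∃ K : ℝ, ∀ ρ, IsState ρ → ((jumpOp C ρ).trace).re ≤ K := by
  refine ⟨2 * (‖C‖ * 4 * ‖Cᴴ‖), fun ρ hρ => ?_⟩
  have h1 : ‖ρ‖ ≤ 4 := (norm_le_of_apply_le ρ 2 (by norm_num) hρ.norm_apply_le_two).trans (by norm_num)
  have h2 : ‖jumpOp C ρ‖ ≤ ‖C‖ * 4 * ‖Cᴴ‖ := by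
    unfold jumpOp
    refine (norm_mul_le _ _).trans ?_
    gcongr
    exact (norm_mul_le _ _).trans (by gcongr)
  refine (Complex.re_le_norm _).trans ?_
  rw [Matrix.trace_fin_two]
  refine (norm_add_le _ _).trans ?_
  linarith [norm_apply_le (jumpOp C ρ) 0 0, norm_apply_le (jumpOp C ρ) 1 1]

end Flow

/-- The state reached from `ρ` at a point of the driving measure with mark `x`. -/
noncomputable def jump (C ρ : Mat) (x : ℝ) : Mat := ρ + jumpCoeff C ρ x

/-- Positivity of the mark matters: at x = 0 with Tr[𝓙(ρ)] = 0 the indicator is on, and `0⁻¹ = 0`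
would send ρ to the zero matrix. -/
lemma IsState.jump {C ρ : Mat} (hρ : IsState ρ) {x : ℝ} (hx : 0 < x) : IsState (jump C ρ x) := by
  unfold JumpBelavkin.jump jumpCoeff
  by_cases h : inJumpRegion C ρ x
  · rw [indicator_of_mem (by exact h), add_sub_cancel]
    refine isState_inv_trace_smul (A := jumpOp C ρ) (hρ.1.mul_mul_conjTranspose_same _) fun h0 => ?_
    have := h.2
    rw [h0] at this
    simp at this
    linarith
  · rwa [indicator_of_notMem (by exact h), add_zero]

/-! ### Lebesgue measure on half-line time and the integrated flow. -/

lemma map_timeMeasure :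
    timeMeasure.map ((↑) : ℝ≥0 → ℝ) = (volume : Measure ℝ).restrict (Ici 0) := by
  have he : MeasurableEmbedding ((↑) : ℝ≥0 → ℝ) := MeasurableEmbedding.subtype_coe measurableSet_Ici
  rw [timeMeasure, he.map_comap]
  congr 1
  exact Subtype.range_coe

lemma measurableEmbedding_coe_nnreal : MeasurableEmbedding ((↑) : ℝ≥0 → ℝ) :=
  MeasurableEmbedding.subtype_coe measurableSet_Ici

lemma map_timeMeasure_restrict_Ioc (s t : ℝ≥0) :
    (timeMeasure.restrict (Ioc s t)).map ((↑) : ℝ≥0 → ℝ) =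
      (volume : Measure ℝ).restrict (Ioc (s : ℝ) t) := by
  have h1 : Ioc s t = ((↑) : ℝ≥0 → ℝ) ⁻¹' Ioc (s : ℝ) t := by
    ext x; simp
  rw [h1, ← measurableEmbedding_coe_nnreal.restrict_map, map_timeMeasure,
    Measure.restrict_restrict measurableSet_Ioc, inter_eq_left.2]
  exact fun x hx => s.2.trans hx.1.le

lemma timeMeasure_Ioc (s t : ℝ≥0) : timeMeasure (Ioc s t) = ENNReal.ofReal (t - s) := by
  have h := congrArg (fun m => m univ) (map_timeMeasure_restrict_Ioc s t)
  simp only [measurableEmbedding_coe_nnreal.map_apply, preimage_univ, Measure.restrict_apply_univ,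
    Real.volume_Ioc] at h
  exact h

lemma integral_drift_flow {H : Mat} (hH : H.IsHermitian) (C : Mat) {Z : Mat} (hZ : IsState Z)
    {s t : ℝ≥0} (hst : s ≤ t) (i j : Fin 2) :
    IntegrableOn (fun u : ℝ≥0 => drift H C (flow H C ((u : ℝ) - s) Z) i j) (Ioc s t) timeMeasure ∧
    ∫ u in Ioc s t, drift H C (flow H C ((u : ℝ) - s) Z) i j ∂timeMeasure =
      flow H C ((t : ℝ) - s) Z i j - Z i j := by
  have hc : Continuous fun u : ℝ => drift H C (flow H C (u - s) Z) i j :=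
    ((continuous_drift H C).comp ((continuous_flow hH C hZ).comp (by fun_prop))).matrix_elem i j
  have hd : ∀ u : ℝ, HasDerivAt (fun u : ℝ => flow H C (u - s) Z i j)
      (drift H C (flow H C (u - s) Z) i j) u :=
    fun u => (hasDerivAt_flow_apply hH C hZ (u - s) i j).comp_sub_const u s
  constructor
  · have h1 := (measurableEmbedding_coe_nnreal.integrable_map_iff
      (μ := timeMeasure.restrict (Ioc s t))
      (g := fun u : ℝ => drift H C (flow H C (u - s) Z) i j)).1
    rw [map_timeMeasure_restrict_Ioc] at h1
    exact h1 hc.integrableOn_Ioc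
  · have h1 := measurableEmbedding_coe_nnreal.integral_map
      (μ := timeMeasure.restrict (Ioc s t))
      (fun u : ℝ => drift H C (flow H C (u - s) Z) i j)
    rw [map_timeMeasure_restrict_Ioc, ← intervalIntegral.integral_of_le (by exact_mod_cast hst),
      intervalIntegral.integral_eq_sub_of_hasDerivAt (fun u _ => hd u)
        (hc.intervalIntegrable _ _)] at h1
    rw [← h1]
    simp [flow_zero H C hZ]

/-! ### The equation at a fixed time and its locality. -/

/-- The equation holds at time `t`. -/
def SolvesAt (H C ρ₀ : Mat) (ν : Measure (ℝ≥0 × ℝ)) (r : ℝ≥0 → Mat) (t : ℝ≥0) : Prop :=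
  ∀ i j : Fin 2,
    IntegrableOn (fun s => drift H C (Function.leftLim r s) i j) (Ioc 0 t) timeMeasure ∧
    IntegrableOn (fun p : ℝ≥0 × ℝ => jumpCoeff C (Function.leftLim r p.1) p.2 i j)
      (Ioc 0 t ×ˢ Ici 0) ν ∧
    r t i j = ρ₀ i j + ∫ s in Ioc 0 t, drift H C (Function.leftLim r s) i j ∂timeMeasure
      + ∫ p in Ioc 0 t ×ˢ Ici 0, jumpCoeff C (Function.leftLim r p.1) p.2 i j ∂ν

lemma SolvesAt.congr_measure {H C ρ₀ : Mat} {ν ν' : Measure (ℝ≥0 × ℝ)} {r : ℝ≥0 → Mat} {t : ℝ≥0}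
    (h : SolvesAt H C ρ₀ ν r t)
    (hν : ν.restrict (Ioc 0 t ×ˢ Ici 0) = ν'.restrict (Ioc 0 t ×ˢ Ici 0)) :
    SolvesAt H C ρ₀ ν' r t := by
  unfold SolvesAt IntegrableOn at h ⊢
  rwa [← hν]

lemma nhdsLT_neBot_of_pos {s : ℝ≥0} (hs : 0 < s) : (𝓝[<] s).NeBot :=
  nhdsLT_neBot_of_exists_lt ⟨0, hs⟩

lemma IsCadlag.tendsto_leftLim {r : ℝ≥0 → Mat} (hr : IsCadlag r) (s : ℝ≥0) :
    Tendsto r (𝓝[<] s) (𝓝 (Function.leftLim r s)) :=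
  tendsto_leftLim_of_tendsto (hr s).2

lemma IsCadlag.leftLim_congr {r r' : ℝ≥0 → Mat} (hr : IsCadlag r) {s : ℝ≥0} (hs : 0 < s)
    (h : ∀ u < s, r u = r' u) : Function.leftLim r s = Function.leftLim r' s := by
  have := nhdsLT_neBot_of_pos hs
  refine (leftLim_eq_of_tendsto ?_).symm
  exact (hr.tendsto_leftLim s).congr' (eventually_nhdsWithin_of_forall h)

lemma SolvesAt.congr_path {H C ρ₀ : Mat} {ν : Measure (ℝ≥0 × ℝ)} {r r' : ℝ≥0 → Mat} {t : ℝ≥0}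
    (h : SolvesAt H C ρ₀ ν r t) (hr : IsCadlag r) (hrr : ∀ u ≤ t, r u = r' u) :
    SolvesAt H C ρ₀ ν r' t := by
  have hl : ∀ s ∈ Ioc 0 t, Function.leftLim r s = Function.leftLim r' s := fun s hs =>
    hr.leftLim_congr hs.1 fun u hu => hrr u (hu.le.trans hs.2)
  intro i j
  obtain ⟨h1, h2, h3⟩ := h i j
  refine ⟨h1.congr_fun (fun s hs => by simp only [hl s hs]) measurableSet_Ioc,
    h2.congr_fun (fun p hp => by simp only [hl p.1 hp.1]) (measurableSet_Ioc.prod measurableSet_Ici),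
    ?_⟩
  rw [← hrr t le_rfl, h3, setIntegral_congr_fun measurableSet_Ioc (fun s hs => by rw [hl s hs]),
    setIntegral_congr_fun (measurableSet_Ioc.prod measurableSet_Ici)
      (fun p hp => by rw [hl p.1 hp.1])]

/-- The right-hand side at t involves left limits on (0, t] only, hence values before t. Agreement
therefore passes through jump times. -/
lemma SolvesAt.eq_of_eq_before {H C ρ₀ : Mat} {ν : Measure (ℝ≥0 × ℝ)} {r r' : ℝ≥0 → Mat} {t : ℝ≥0}
    (h : SolvesAt H C ρ₀ ν r t) (h' : SolvesAt H C ρ₀ ν r' t) (hr : IsCadlag r)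
    (hrr : ∀ u < t, r u = r' u) : r t = r' t := by
  have hl : ∀ s ∈ Ioc 0 t, Function.leftLim r s = Function.leftLim r' s := fun s hs =>
    hr.leftLim_congr hs.1 fun u hu => hrr u (hu.trans_le hs.2)
  ext i j
  rw [(h i j).2.2, (h' i j).2.2,
    setIntegral_congr_fun measurableSet_Ioc (fun s hs => by rw [hl s hs]),
    setIntegral_congr_fun (measurableSet_Ioc.prod measurableSet_Ici)
      (fun p hp => by rw [hl p.1 hp.1])]

/-- Increment of a solution over an interval carrying no jump. -/
lemma SolvesAt.increment {H C ρ₀ : Mat} {ν : Measure (ℝ≥0 × ℝ)} {r : ℝ≥0 → Mat} {s t : ℝ≥0}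
    (hs : SolvesAt H C ρ₀ ν r s) (ht : SolvesAt H C ρ₀ ν r t) (hst : s ≤ t) {k : ℝ}
    (hk : ∀ u ∈ Ioc s t, ((jumpOp C (Function.leftLim r u)).trace).re ≤ k)
    (hν : ν (Ioc s t ×ˢ Icc 0 k) = 0) (i j : Fin 2) :
    IntegrableOn (fun s => drift H C (Function.leftLim r s) i j) (Ioc s t) timeMeasure ∧
    r t i j = r s i j + ∫ u in Ioc s t, drift H C (Function.leftLim r u) i j ∂timeMeasure := by
  obtain ⟨h1, h2, h3⟩ := hs i j
  obtain ⟨h4, h5, h6⟩ := ht i j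
  have hd : IntegrableOn (fun s => drift H C (Function.leftLim r s) i j) (Ioc s t) timeMeasure :=
    h4.mono_set (Ioc_subset_Ioc_left zero_le)
  refine ⟨hd, ?_⟩
  have e1 : Ioc 0 t = Ioc 0 s ∪ Ioc s t := (Ioc_union_Ioc_eq_Ioc zero_le hst).symm
  have e2 : Ioc 0 t ×ˢ Ici (0 : ℝ) = Ioc 0 s ×ˢ Ici 0 ∪ Ioc s t ×ˢ Ici 0 := by
    rw [e1, union_prod]
  have hdis : Disjoint (Ioc 0 s) (Ioc s t) := Ioc_disjoint_Ioc_of_le le_rfl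
  have hz : ∫ p in Ioc s t ×ˢ Ici 0, jumpCoeff C (Function.leftLim r p.1) p.2 i j ∂ν = 0 := by
    refine integral_eq_zero_of_ae ?_
    have hms : MeasurableSet (Ioc s t ×ˢ Ici (0 : ℝ)) := measurableSet_Ioc.prod measurableSet_Ici
    refine (ae_restrict_iff' hms).2 ?_
    have := measure_eq_zero_iff_ae_notMem.1 hν
    filter_upwards [this] with p hp hp'
    -- A point of (s, t] that acts has mark at most the rate, hence at most k, and almost no point
    -- is of this kind.
    have : ¬ inJumpRegion C (Function.leftLim r p.1) p.2 := fun h =>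
      hp ⟨hp'.1, h.1, h.2.trans (hk _ hp'.1)⟩
    simp only [jumpCoeff]
    rw [indicator_of_notMem (by exact this)]
    rfl
  rw [h6, h3, e2, setIntegral_union (Disjoint.set_prod_left hdis _ _)
    (measurableSet_Ioc.prod measurableSet_Ici) h2
    (h5.mono_set (prod_mono (Ioc_subset_Ioc_left zero_le) subset_rfl)), hz, e1,
    setIntegral_union hdis measurableSet_Ioc h1 hd]
  ring

/-- The sets decrease to the empty set as b ↓ s, so their mass falls below 1, and integrality makes
it 0. -/
lemma exists_no_points_right {ν : Measure (ℝ≥0 × ℝ)}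
    (hint : ∀ A : Set (ℝ≥0 × ℝ), MeasurableSet A → ∃ n : ℕ∞, ν A = (n : ℝ≥0∞))
    {s T : ℝ≥0} (hsT : s < T) {k : ℝ} (hfin : ν (Ioc s T ×ˢ Icc 0 k) ≠ ∞) :
    ∃ b, s < b ∧ ν (Ioc s b ×ˢ Icc 0 k) = 0 := by
  have hm : ∀ b, MeasurableSet (Ioc s b ×ˢ Icc 0 k) := fun b =>
    measurableSet_Ioc.prod measurableSet_Icc
  have h := tendsto_measure_biInter_gt (μ := ν) (s := fun b => Ioc s b ×ˢ Icc 0 k) (a := s)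
    (fun b _ => (hm b).nullMeasurableSet)
    (fun b c _ hbc => prod_mono (Ioc_subset_Ioc_right hbc) subset_rfl) ⟨T, hsT, hfin⟩
  have h0 : (⋂ b, ⋂ (_ : b > s), Ioc s b ×ˢ Icc 0 k) = ∅ := by
    refine eq_empty_of_forall_notMem fun p hp => ?_
    simp only [mem_iInter] at hp
    obtain ⟨c, hc, hc'⟩ := exists_between (hp T hsT).1.1
    exact absurd (hp c hc).1.2 (not_le.2 hc')
  rw [h0, measure_empty] at h
  have : (𝓝[>] s).NeBot := nhdsGT_neBot_of_exists_gt ⟨T, hsT⟩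
  obtain ⟨b, hb, hsb⟩ := ((h.eventually (gt_mem_nhds zero_lt_one)).and
    self_mem_nhdsWithin).exists
  refine ⟨b, hsb, ?_⟩
  obtain ⟨n, hn⟩ := hint _ (hm b)
  simp only [Function.comp] at hb
  rw [hn] at hb ⊢
  have : n < 1 := by exact_mod_cast hb
  rw [Order.lt_one_iff.1 this, ENat.toENNReal_zero]

/-! ### Pathwise uniqueness. -/

section Unique

open scoped Matrix.Norms.Operator

/-- A uniform bound M on the difference improves to M/2: the integral equation gives M/4 for each
entry, and passing from entries to the norm costs a factor 2. Iteration starts from 2ε, the diameter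
bound of the ball. -/
lemma eqOn_of_contraction {H C : Mat} {r r' : ℝ≥0 → Mat} (hr : IsCadlag r) (hr' : IsCadlag r')
    {s b : ℝ≥0} {L ε : ℝ} {z : Mat} (hL0 : 0 ≤ L)
    (hL : ∀ a b : Mat, a ∈ Metric.closedBall z ε → b ∈ Metric.closedBall z ε →
      ‖drift H C a - drift H C b‖ ≤ L * ‖a - b‖)
    (hz : ∀ u ∈ Ico s b, r u ∈ Metric.closedBall z ε)
    (hz' : ∀ u ∈ Ico s b, r' u ∈ Metric.closedBall z ε)
    (hb : L * (b - s) ≤ 1 / 4) (h0 : r s = r' s)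
    (hi : ∀ t ∈ Ico s b, ∀ i j,
      IntegrableOn (fun s => drift H C (Function.leftLim r s) i j) (Ioc s t) timeMeasure ∧
      r t i j = r s i j + ∫ u in Ioc s t, drift H C (Function.leftLim r u) i j ∂timeMeasure)
    (hi' : ∀ t ∈ Ico s b, ∀ i j,
      IntegrableOn (fun s => drift H C (Function.leftLim r' s) i j) (Ioc s t) timeMeasure ∧
      r' t i j = r' s i j + ∫ u in Ioc s t, drift H C (Function.leftLim r' u) i j ∂timeMeasure) :
    ∀ t ∈ Ico s b, r t = r' t := by
  have hev : ∀ u ∈ Ioo s b, ∀ᶠ v in 𝓝[<] u, v ∈ Ico s b := fun u hu => by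
    filter_upwards [Ico_mem_nhdsLT hu.1] with v hv using ⟨hv.1, hv.2.trans hu.2⟩
  have hne : ∀ u ∈ Ioo s b, (𝓝[<] u).NeBot := fun u hu =>
    nhdsLT_neBot_of_pos (zero_le.trans_lt hu.1)
  have hl : ∀ u ∈ Ioo s b, Function.leftLim r u ∈ Metric.closedBall z ε := fun u hu => by
    have := hne u hu
    exact Metric.isClosed_closedBall.mem_of_tendsto (hr.tendsto_leftLim u)
      ((hev u hu).mono fun v hv => hz v hv)
  have hl' : ∀ u ∈ Ioo s b, Function.leftLim r' u ∈ Metric.closedBall z ε := fun u hu => by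
    have := hne u hu
    exact Metric.isClosed_closedBall.mem_of_tendsto (hr'.tendsto_leftLim u)
      ((hev u hu).mono fun v hv => hz' v hv)
  have step : ∀ M : ℝ, 0 ≤ M → (∀ t ∈ Ico s b, ‖r t - r' t‖ ≤ M) →
      ∀ t ∈ Ico s b, ‖r t - r' t‖ ≤ M / 2 := by
    intro M hM hrM t ht
    have hlM : ∀ u ∈ Ioo s b, ‖Function.leftLim r u - Function.leftLim r' u‖ ≤ M := fun u hu => by
      have := hne u hu
      refine le_of_tendsto ((hr.tendsto_leftLim u).sub (hr'.tendsto_leftLim u)).norm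
        ((hev u hu).mono fun v hv => hrM v hv)
    have hent : ∀ i j, ‖(r t - r' t) i j‖ ≤ M / 4 := by
      intro i j
      obtain ⟨h1, h2⟩ := hi t ht i j
      obtain ⟨h3, h4⟩ := hi' t ht i j
      rw [Matrix.sub_apply, h2, h4, h0, add_sub_add_left_eq_sub, ← integral_sub h1 h3]
      refine (norm_setIntegral_le_of_norm_le_const (C := L * M) ?_ ?_).trans ?_
      · rw [timeMeasure_Ioc]; exact ENNReal.ofReal_lt_top
      · intro u hu
        have hu' : u ∈ Ioo s b := ⟨hu.1, hu.2.trans_lt ht.2⟩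
        rw [← Matrix.sub_apply]
        refine (norm_apply_le _ i j).trans ((hL _ _ (hl u hu') (hl' u hu')).trans ?_)
        exact mul_le_mul_of_nonneg_left (hlM u hu') hL0
      · have h5 : (s : ℝ) ≤ t := by exact_mod_cast ht.1
        have h6 : (t : ℝ) ≤ b := by exact_mod_cast ht.2.le
        rw [Measure.real, timeMeasure_Ioc, ENNReal.toReal_ofReal (by linarith)]
        calc L * M * (t - s) = M * (L * (t - s)) := by ring
          _ ≤ M * (1 / 4) := by
            refine mul_le_mul_of_nonneg_left (le_trans ?_ hb) hM
            exact mul_le_mul_of_nonneg_left (by linarith) hL0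
          _ = M / 4 := by ring
    exact (norm_le_of_apply_le _ _ (by linarith) hent).trans (by linarith)
  intro t ht
  have hε : 0 ≤ ε := Metric.nonempty_closedBall.1 ⟨_, hz t ht⟩
  have hn : ∀ n : ℕ, ∀ t ∈ Ico s b, ‖r t - r' t‖ ≤ 2 * ε * (1 / 2) ^ n := by
    intro n
    induction n with
    | zero =>
      intro t ht
      have h1 := dist_triangle_right (r t) (r' t) z
      rw [dist_eq_norm] at h1
      have h2 := Metric.mem_closedBall.1 (hz t ht)
      have h3 := Metric.mem_closedBall.1 (hz' t ht)
      simp only [pow_zero]; linarith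
    | succ n ih =>
      intro t ht
      refine (step _ (by positivity) ih t ht).trans (le_of_eq ?_)
      rw [pow_succ]; ring
  have hlim : Tendsto (fun n : ℕ => 2 * ε * (1 / 2 : ℝ) ^ n) atTop (𝓝 0) := by
    simpa using (tendsto_pow_atTop_nhds_zero_of_lt_one (r := (1 / 2 : ℝ)) (by norm_num)
      (by norm_num)).const_mul (2 * ε)
  exact sub_eq_zero.1 (norm_le_zero_iff.1 (ge_of_tendsto' hlim fun n => hn n t ht))

/-- Two càdlàg paths which solve the equation up to time `T` agree up to time `T`. -/
theorem eq_of_solvesAt {H C ρ₀ : Mat} {ν : Measure (ℝ≥0 × ℝ)} {r r' : ℝ≥0 → Mat} {T : ℝ≥0}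
    (hint : ∀ A : Set (ℝ≥0 × ℝ), MeasurableSet A → ∃ n : ℕ∞, ν A = (n : ℝ≥0∞))
    (hfin : ∀ k : ℝ, ν (Ioc 0 T ×ˢ Icc 0 k) ≠ ∞) (hr : IsCadlag r) (hr' : IsCadlag r')
    (h : ∀ t ≤ T, SolvesAt H C ρ₀ ν r t) (h' : ∀ t ≤ T, SolvesAt H C ρ₀ ν r' t) :
    ∀ t ≤ T, r t = r' t := by
  by_contra! hcon
  obtain ⟨t₀, ht₀, hne⟩ := hcon
  set E : Set ℝ≥0 := {t | t ≤ T ∧ r t ≠ r' t} with hE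
  have hEne : E.Nonempty := ⟨t₀, ht₀, hne⟩
  set s := sInf E with hs
  have hsE : ∀ e ∈ E, s ≤ e := fun e he => csInf_le (OrderBot.bddBelow _) he
  have hbefore : ∀ u < s, r u = r' u := by
    intro u hu
    by_contra hc
    have hst : s ≤ T := (hsE _ ⟨ht₀, hne⟩).trans ht₀
    exact absurd (hsE u ⟨hu.le.trans hst, hc⟩) (not_le.2 hu)
  have hsT' : s ≤ T := (hsE _ ⟨ht₀, hne⟩).trans ht₀
  have hrs : r s = r' s := (h s hsT').eq_of_eq_before (h' s hsT') hr hbefore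
  have hst₀ : s < t₀ := lt_of_le_of_ne (hsE _ ⟨ht₀, hne⟩) fun hc => hne (hc ▸ hrs)
  have hsT : s < T := hst₀.trans_le ht₀
  obtain ⟨L, hL0, ε₁, hε₁, hL⟩ := exists_lipschitz_drift H C (r s)
  -- The margin 1 keeps k above the rate throughout a neighbourhood of `r s`.
  set k := ((jumpOp C (r s)).trace).re + 1 with hk
  have hknhds : ∀ᶠ a in 𝓝 (r s), ((jumpOp C a).trace).re ≤ k :=
    ((continuous_trace_jumpOp C).tendsto (r s)).eventually (Iic_mem_nhds (by rw [hk]; linarith))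
  obtain ⟨ε₂, hε₂, hsub⟩ := Metric.nhds_basis_closedBall.mem_iff.1 hknhds
  set ε := min ε₁ ε₂ with hε
  have hεpos : 0 < ε := lt_min hε₁ hε₂
  obtain ⟨b₁, hsb₁, hb₁⟩ := exists_no_points_right hint hsT (k := k)
    (ne_top_of_le_ne_top (hfin k) (measure_mono (prod_mono (Ioc_subset_Ioc_left zero_le) subset_rfl)))
  have hev : ∀ᶠ u in 𝓝[≥] s, r u ∈ Metric.closedBall (r s) ε ∧ r' u ∈ Metric.closedBall (r s) ε := by
    refine ((hr s).1.eventually (Metric.closedBall_mem_nhds _ hεpos)).and ?_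
    exact (hr' s).1.eventually (hrs ▸ Metric.closedBall_mem_nhds _ hεpos)
  obtain ⟨b₂, hsb₂, hb₂⟩ := (mem_nhdsGE_iff_exists_Ico_subset' hsT).1 hev
  -- Chosen so that Lδ ≤ 1/4; using L + 1 avoids dividing by zero.
  set δ : ℝ≥0 := Real.toNNReal (1 / (4 * (L + 1))) with hδ
  have hδpos : 0 < δ := Real.toNNReal_pos.2 (by positivity)
  set b := min (min b₁ b₂) (min T (s + δ)) with hb
  have hsb : s < b := lt_min (lt_min hsb₁ hsb₂) (lt_min hsT (lt_add_of_pos_right s hδpos))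
  have hbb₁ : b ≤ b₁ := (min_le_left _ _).trans (min_le_left _ _)
  have hbb₂ : b ≤ b₂ := (min_le_left _ _).trans (min_le_right _ _)
  have hbT : b ≤ T := (min_le_right _ _).trans (min_le_left _ _)
  have hbδ : b ≤ s + δ := (min_le_right _ _).trans (min_le_right _ _)
  have hball : ∀ u ∈ Ico s b, r u ∈ Metric.closedBall (r s) ε ∧ r' u ∈ Metric.closedBall (r s) ε :=
    fun u hu => hb₂ ⟨hu.1, hu.2.trans_le hbb₂⟩
  have hkl : ∀ q : ℝ≥0 → Mat, IsCadlag q → (∀ u ∈ Ico s b, q u ∈ Metric.closedBall (r s) ε) →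
      ∀ t ∈ Ico s b, ∀ u ∈ Ioc s t, ((jumpOp C (Function.leftLim q u)).trace).re ≤ k := by
    intro q hq hqb t ht u hu
    have := nhdsLT_neBot_of_pos (zero_le.trans_lt hu.1)
    refine le_of_tendsto (((continuous_trace_jumpOp C).tendsto _).comp (hq.tendsto_leftLim u)) ?_
    filter_upwards [Ico_mem_nhdsLT hu.1] with v hv
    exact hsub (Metric.closedBall_subset_closedBall (min_le_right _ _)
      (hqb v ⟨hv.1, hv.2.trans (hu.2.trans_lt ht.2)⟩))
  have hνt : ∀ t ∈ Ico s b, ν (Ioc s t ×ˢ Icc 0 k) = 0 := fun t ht =>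
    measure_mono_null (prod_mono (Ioc_subset_Ioc_right (ht.2.le.trans hbb₁)) subset_rfl) hb₁
  have hmain := eqOn_of_contraction (H := H) (C := C) hr hr' (s := s) (b := b) (z := r s) hL0
    (fun x y hx hy => hL x y (Metric.closedBall_subset_closedBall (min_le_left _ _) hx)
      (Metric.closedBall_subset_closedBall (min_le_left _ _) hy))
    (fun u hu => (hball u hu).1) (fun u hu => (hball u hu).2)
    (by
      have h1 : (b : ℝ) ≤ s + δ := by exact_mod_cast hbδ
      have h2 : (δ : ℝ) = 1 / (4 * (L + 1)) := Real.coe_toNNReal _ (by positivity)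
      calc L * (b - s) ≤ L * (1 / (4 * (L + 1))) :=
            mul_le_mul_of_nonneg_left (by linarith) hL0
        _ ≤ 1 / 4 := by rw [mul_one_div, div_le_div_iff₀ (by positivity) (by norm_num)]; linarith)
    hrs
    (fun t ht => (h s hsT').increment (h t (ht.2.le.trans hbT)) ht.1
      (hkl r hr (fun u hu => (hball u hu).1) t ht) (hνt t ht))
    (fun t ht => (h' s hsT').increment (h' t (ht.2.le.trans hbT)) ht.1
      (hkl r' hr' (fun u hu => (hball u hu).2) t ht) (hνt t ht))
  obtain ⟨e, he, heb⟩ := exists_lt_of_csInf_lt hEne hsb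
  exact he.2 (hmain e ⟨hsE e he, heb⟩)

end Unique

/-! ### Finite configurations and their last point. -/

/-- Finite configurations of points of `(0, T] × (0, K]` with distinct times. -/
structure IsConfig (T : ℝ≥0) (K : ℝ) (ν : Measure (ℝ≥0 × ℝ)) : Prop where
  slice : ∀ t : ℝ≥0, ν ({t} ×ˢ univ) ≤ 1
  integer : ∀ A : Set (ℝ≥0 × ℝ), MeasurableSet A → ∃ n : ℕ∞, ν A = (n : ℝ≥0∞)
  support : ν (Ioc 0 T ×ˢ Ioc 0 K)ᶜ = 0
  finite : ν univ ≠ ∞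

lemma IsConfig.restrict {T : ℝ≥0} {K : ℝ} {ν : Measure (ℝ≥0 × ℝ)} (h : IsConfig T K ν)
    {B : Set (ℝ≥0 × ℝ)} (hB : MeasurableSet B) : IsConfig T K (ν.restrict B) where
  slice t := (Measure.restrict_apply_le _ _).trans (h.slice t)
  integer A hA := by rw [Measure.restrict_apply hA]; exact h.integer _ (hA.inter hB)
  support := le_antisymm ((Measure.restrict_apply_le _ _).trans h.support.le) zero_le
  finite := ne_top_of_le_ne_top h.finite (Measure.restrict_apply_le _ _)

/-- The time of the last point of a configuration. -/
noncomputable def lastTime (ν : Measure (ℝ≥0 × ℝ)) : ℝ≥0 := sInf {a | ν (Ioi a ×ˢ univ) = 0}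

/-- The configuration with its last point removed. -/
noncomputable def beforeLast (ν : Measure (ℝ≥0 × ℝ)) : Measure (ℝ≥0 × ℝ) :=
  ν.restrict (Iio (lastTime ν) ×ˢ univ)

/-- The mark of the last point of a configuration. -/
noncomputable def lastMark (ν : Measure (ℝ≥0 × ℝ)) : ℝ :=
  (∫⁻ p, ENNReal.ofReal p.2 ∂ν).toReal - (∫⁻ p, ENNReal.ofReal p.2 ∂(beforeLast ν)).toReal

section LastPoint

variable {T : ℝ≥0} {K : ℝ} {ν : Measure (ℝ≥0 × ℝ)}

lemma measure_Ioi_prod_eq_zero {ν : Measure (ℝ≥0 × ℝ)} {s : ℝ≥0}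
    (h : ∀ a > s, ν (Ioi a ×ˢ univ) = 0) : ν (Ioi s ×ˢ univ) = 0 := by
  obtain ⟨u, -, hu, hlim⟩ := exists_seq_strictAnti_tendsto s
  have : Ioi s ×ˢ (univ : Set ℝ) = ⋃ n, Ioi (u n) ×ˢ univ := by
    ext p
    simp only [mem_prod, mem_Ioi, mem_univ, and_true, mem_iUnion]
    exact ⟨fun hp => (hlim.eventually (gt_mem_nhds hp)).exists, fun ⟨n, hn⟩ => (hu n).trans hn⟩
  rw [this]
  exact measure_iUnion_null fun n => h _ (hu n)

lemma IsConfig.measure_Ioi_eq_zero (h : IsConfig T K ν) : ν (Ioi T ×ˢ univ) = 0 :=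
  measure_mono_null (show Ioi T ×ˢ univ ⊆ (Ioc 0 T ×ˢ Ioc 0 K)ᶜ from
    fun _ hp hp' => absurd hp'.1.2 (not_le.2 hp.1)) h.support

lemma IsConfig.measure_Ioi_lastTime (h : IsConfig T K ν) : ν (Ioi (lastTime ν) ×ˢ univ) = 0 := by
  refine measure_Ioi_prod_eq_zero fun a ha => ?_
  obtain ⟨b, hb, hba⟩ := exists_lt_of_csInf_lt (s := {a | ν (Ioi a ×ˢ univ) = 0})
    ⟨T, h.measure_Ioi_eq_zero⟩ ha
  exact measure_mono_null (prod_mono (Ioi_subset_Ioi hba.le) subset_rfl) hb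

lemma IsConfig.one_le_of_ne_zero (h : IsConfig T K ν) {A : Set (ℝ≥0 × ℝ)} (hA : MeasurableSet A)
    (h0 : ν A ≠ 0) : 1 ≤ ν A := by
  obtain ⟨n, hn⟩ := h.integer A hA
  rw [hn] at h0 ⊢
  have : n ≠ 0 := by rintro rfl; simp at h0
  exact_mod_cast Order.one_le_iff_ne_zero.2 this

lemma IsConfig.one_le_of_lt_lastTime (h : IsConfig T K ν) {a : ℝ≥0} (ha : a < lastTime ν) :
    1 ≤ ν (Ioi a ×ˢ univ) :=
  h.one_le_of_ne_zero (measurableSet_Ioi.prod .univ) fun h0 =>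
    absurd (csInf_le (s := {a | ν (Ioi a ×ˢ univ) = 0}) (OrderBot.bddBelow _) h0) (not_le.2 ha)

lemma IsConfig.lastTime_pos (h : IsConfig T K ν) (h0 : ν ≠ 0) : 0 < lastTime ν := by
  by_contra hc
  have h1 := h.measure_Ioi_lastTime
  rw [nonpos_iff_eq_zero.1 (not_lt.1 hc)] at h1
  refine h0 (Measure.measure_univ_eq_zero.1 ?_)
  refine measure_mono_null (fun p _ => ?_) (measure_union_null h1 h.support)
  by_cases hp : p ∈ Ioc 0 T ×ˢ Ioc 0 K
  · exact Or.inl ⟨hp.1.1, trivial⟩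
  · exact Or.inr hp

lemma IsConfig.measure_lastTime (h : IsConfig T K ν) (h0 : ν ≠ 0) :
    ν ({lastTime ν} ×ˢ univ) = 1 := by
  -- Every interval after some u n below the last time carries a point. Finite mass allows passing
  -- to the intersection, which leaves mass at least 1 at or after the last time.
  obtain ⟨u, hu, hmem, hlim⟩ := exists_seq_strictMono_tendsto' (h.lastTime_pos h0)
  have h1 := tendsto_measure_iInter_atTop (μ := ν) (s := fun n => Ioi (u n) ×ˢ (univ : Set ℝ))
    (fun n => (measurableSet_Ioi.prod .univ).nullMeasurableSet)
    (fun m n hmn => prod_mono (Ioi_subset_Ioi (hu.monotone hmn)) subset_rfl)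
    ⟨0, ne_top_of_le_ne_top h.finite (measure_mono (subset_univ _))⟩
  have h2 : 1 ≤ ν (⋂ n, Ioi (u n) ×ˢ (univ : Set ℝ)) :=
    ge_of_tendsto' h1 fun n => h.one_le_of_lt_lastTime (hmem n).2
  have h3 : (⋂ n, Ioi (u n) ×ˢ (univ : Set ℝ)) ⊆
      {lastTime ν} ×ˢ univ ∪ Ioi (lastTime ν) ×ˢ univ := by
    intro p hp
    simp only [mem_iInter] at hp
    have : lastTime ν ≤ p.1 := le_of_tendsto' hlim fun n => (hp n).1.le
    rcases this.eq_or_lt with h | h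
    · exact Or.inl ⟨h.symm, trivial⟩
    · exact Or.inr ⟨h, trivial⟩
  refine le_antisymm (h.slice _) (h2.trans ((measure_mono h3).trans ((measure_union_le _ _).trans ?_)))
  rw [h.measure_Ioi_lastTime, add_zero]

/-- What remains after removing the earlier points has integer values and total mass 1. It is thus a
zero-one measure, hence a Dirac mass. -/
lemma IsConfig.exists_eq_add_dirac (h : IsConfig T K ν) (h0 : ν ≠ 0) :
    ∃ c, 0 < c ∧ ν = beforeLast ν + Measure.dirac (lastTime ν, c) := by
  have hm : MeasurableSet (Iio (lastTime ν) ×ˢ (univ : Set ℝ)) := measurableSet_Iio.prod .univ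
  have hdec := Measure.restrict_add_restrict_compl (μ := ν) hm
  have hle : ν (Iio (lastTime ν) ×ˢ (univ : Set ℝ))ᶜ = 1 := by
    refine le_antisymm ?_ ((h.measure_lastTime h0).symm.le.trans (measure_mono ?_))
    · refine (measure_mono (t := {lastTime ν} ×ˢ univ ∪ Ioi (lastTime ν) ×ˢ univ) ?_).trans
        ((measure_union_le _ _).trans ?_)
      · intro p hp
        have : lastTime ν ≤ p.1 := not_lt.1 fun hc => hp ⟨hc, trivial⟩
        rcases this.eq_or_lt with h | h
        · exact Or.inl ⟨h.symm, trivial⟩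
        · exact Or.inr ⟨h, trivial⟩
      · rw [h.measure_Ioi_lastTime, add_zero]; exact h.slice _
    · intro p hp hp'
      exact absurd hp'.1 (mem_singleton_iff.1 hp.1).not_lt
  set σ := ν.restrict (Iio (lastTime ν) ×ˢ (univ : Set ℝ))ᶜ with hσ
  have hσc : IsConfig T K σ := h.restrict hm.compl
  have hσ1 : σ univ = 1 := by rw [hσ, Measure.restrict_apply_univ, hle]
  have : IsZeroOneMeasure σ := ⟨fun s hs => by
    rcases eq_or_ne (σ s) 0 with h | h
    · exact Or.inl h
    · exact Or.inr (le_antisymm (hσ1 ▸ measure_mono (subset_univ s))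
        (hσc.one_le_of_ne_zero hs h))⟩
  have : NeZero σ := ⟨fun hz => by simp [hz] at hσ1⟩
  obtain ⟨x, hx⟩ := IsZeroOneMeasure.exists_eq_dirac (μ := σ)
  have hbox : x ∈ Ioc 0 T ×ˢ Ioc 0 K := by
    by_contra hc
    have h1 := hσc.support
    rw [hx, Measure.dirac_apply' _ (measurableSet_Ioc.prod measurableSet_Ioc).compl,
      indicator_of_mem (by exact hc)] at h1
    simp at h1
  have hx1 : x.1 = lastTime ν := by
    by_contra hc
    have h1 : σ ({lastTime ν} ×ˢ univ) = 1 := by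
      rw [hσ, Measure.restrict_apply ((measurableSet_singleton _).prod .univ), inter_eq_left.2,
        h.measure_lastTime h0]
      intro p hp hp'
      exact absurd hp'.1 (mem_singleton_iff.1 hp.1).not_lt
    rw [hx, Measure.dirac_apply' _ ((measurableSet_singleton _).prod .univ),
      indicator_of_notMem (fun hp => hc hp.1)] at h1
    simp at h1
  refine ⟨x.2, hbox.2.1, ?_⟩
  rw [beforeLast, ← hx1, Prod.mk.eta, ← hx, hx1, hσ, hdec]

lemma IsConfig.lintegral_mark_ne_top (h : IsConfig T K ν) :
    ∫⁻ p, ENNReal.ofReal p.2 ∂ν ≠ ∞ := by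
  refine ne_top_of_le_ne_top (b := ENNReal.ofReal K * ν univ)
    (ENNReal.mul_ne_top ENNReal.ofReal_ne_top h.finite) ?_
  rw [← lintegral_const]
  refine lintegral_mono_ae ?_
  filter_upwards [measure_eq_zero_iff_ae_notMem.1 h.support] with p hp
  exact ENNReal.ofReal_le_ofReal (not_not.1 hp).2.2

/-- The mark is recovered as a difference of sums of marks, an expression measurable in ν, unlike a
chosen witness. Finiteness of these sums makes the subtraction legitimate. -/
lemma IsConfig.eq_add_dirac (h : IsConfig T K ν) (h0 : ν ≠ 0) :
    0 < lastMark ν ∧ ν = beforeLast ν + Measure.dirac (lastTime ν, lastMark ν) := by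
  obtain ⟨c, hc, heq⟩ := h.exists_eq_add_dirac h0
  have hb : IsConfig T K (beforeLast ν) := h.restrict (measurableSet_Iio.prod .univ)
  have hcm : lastMark ν = c := by
    have : ∫⁻ p, ENNReal.ofReal p.2 ∂ν
        = ∫⁻ p, ENNReal.ofReal p.2 ∂(beforeLast ν) + ENNReal.ofReal c := by
      conv_lhs => rw [heq]
      rw [lintegral_add_measure, lintegral_dirac]
    rw [lastMark, this, ENNReal.toReal_add hb.lintegral_mark_ne_top ENNReal.ofReal_ne_top,
      ENNReal.toReal_ofReal hc.le, add_sub_cancel_left]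
  rw [hcm]
  exact ⟨hc, heq⟩

lemma IsConfig.measure_beforeLast_le (h : IsConfig T K ν) (h0 : ν ≠ 0) {n : ℕ}
    (hn : ν univ ≤ (n + 1 : ℕ)) : beforeLast ν univ ≤ n := by
  have h1 := congrArg (fun m => m univ) (h.eq_add_dirac h0).2
  simp only [Measure.add_apply, measure_univ] at h1
  rw [h1, Nat.cast_add, Nat.cast_one] at hn
  exact (ENNReal.add_le_add_iff_right ENNReal.one_ne_top).1 hn

end LastPoint

/-! ### Construction of the solution by adding points. -/

/-- A càdlàg path of states solving the equation, which jumps only at the points of `ν`. -/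
structure IsStatePath (H C ρ₀ : Mat) (ν : Measure (ℝ≥0 × ℝ)) (r : ℝ≥0 → Mat) : Prop where
  state : ∀ t, IsState (r t)
  cadlag : IsCadlag r
  solves : ∀ t, SolvesAt H C ρ₀ ν r t
  continuousAt : ∀ s, ν ({s} ×ˢ univ) = 0 → ContinuousAt r s

lemma continuous_flow_sub {H : Mat} (hH : H.IsHermitian) (C : Mat) {Z : Mat} (hZ : IsState Z)
    (s : ℝ≥0) : Continuous (fun t : ℝ≥0 => flow H C ((t : ℝ) - s) Z) :=
  (continuous_flow hH C hZ).comp (by fun_prop)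

lemma leftLim_eq_of_continuousAt {r : ℝ≥0 → Mat} {s : ℝ≥0} (h : ContinuousAt r s) :
    Function.leftLim r s = r s :=
  h.continuousWithinAt.leftLim_eq

lemma isStatePath_zero {H : Mat} (hH : H.IsHermitian) (C : Mat) {ρ₀ : Mat} (hρ₀ : IsState ρ₀) :
    IsStatePath H C ρ₀ 0 (fun t => flow H C t ρ₀) := by
  have hc : Continuous (fun t : ℝ≥0 => flow H C t ρ₀) := by
    simpa using continuous_flow_sub hH C hρ₀ 0
  refine ⟨fun t => hρ₀.flow H C t, fun t => ⟨hc.continuousWithinAt, _, hc.continuousWithinAt⟩,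
    fun t i j => ?_, fun s _ => hc.continuousAt⟩
  have h := integral_drift_flow hH C hρ₀ (zero_le : 0 ≤ t) i j
  simp only [NNReal.coe_zero, sub_zero] at h
  simp only [leftLim_eq_of_continuousAt hc.continuousAt]
  refine ⟨h.1, by simp [IntegrableOn], ?_⟩
  rw [h.2]
  simp

/-- Adding a point with time `S` and mark `c` after all points of `ν`. -/
lemma IsStatePath.add_dirac {H : Mat} (hH : H.IsHermitian) {C ρ₀ : Mat}
    {ν : Measure (ℝ≥0 × ℝ)} {r : ℝ≥0 → Mat} (h : IsStatePath H C ρ₀ ν r) {S : ℝ≥0} {c : ℝ}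
    (hS : 0 < S) (hc : 0 < c) (hν : ν (Iio S ×ˢ univ)ᶜ = 0) :
    IsStatePath H C ρ₀ (ν + Measure.dirac (S, c))
      (fun t => if t < S then r t else flow H C ((t : ℝ) - S) (jump C (r S) c)) := by
  set Z := jump C (r S) c with hZdef
  have hZ : IsState Z := (h.state S).jump hc
  set q : ℝ≥0 → Mat := fun t => if t < S then r t else flow H C ((t : ℝ) - S) Z with hq
  have hcf := continuous_flow_sub hH C hZ S
  have hq_lt : ∀ t < S, q t = r t := fun t ht => by simp [hq, ht]
  have hq_ge : ∀ t, S ≤ t → q t = flow H C ((t : ℝ) - S) Z := fun t ht => by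
    simp [hq, not_lt.2 ht]
  have hev_lt : ∀ t < S, q =ᶠ[𝓝 t] r := fun t ht => by
    filter_upwards [gt_mem_nhds ht] with u hu using hq_lt u hu
  have hev_gt : ∀ t, S < t → q =ᶠ[𝓝 t] fun t => flow H C ((t : ℝ) - S) Z := fun t ht => by
    filter_upwards [lt_mem_nhds ht] with u hu using hq_ge u hu.le
  have hcont_gt : ∀ t, S < t → ContinuousAt q t := fun t ht =>
    hcf.continuousAt.congr (hev_gt t ht).symm
  -- Without a point of ν at S the left limit there is `r S`, the matrix from which the new jump is
  -- computed.
  have hrS : ContinuousAt r S := h.continuousAt S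
    (measure_mono_null (show {S} ×ˢ univ ⊆ (Iio S ×ˢ univ)ᶜ from
      fun _ hp hp' => absurd hp'.1 (mem_singleton_iff.1 hp.1).not_lt) hν)
  have hqcad : IsCadlag q := by
    intro t
    rcases lt_trichotomy t S with ht | ht | ht
    · refine ⟨(h.cadlag t).1.congr_of_eventuallyEq ((hev_lt t ht).filter_mono nhdsWithin_le_nhds)
        (hq_lt t ht), ?_⟩
      obtain ⟨l, hl⟩ := (h.cadlag t).2
      exact ⟨l, hl.congr' ((hev_lt t ht).filter_mono nhdsWithin_le_nhds).symm⟩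
    · subst ht
      refine ⟨hcf.continuousWithinAt.congr (fun u hu => hq_ge u hu) (hq_ge t le_rfl), ?_⟩
      obtain ⟨l, hl⟩ := (h.cadlag t).2
      exact ⟨l, hl.congr' (eventually_nhdsWithin_of_forall fun u hu => (hq_lt u hu).symm)⟩
    · exact ⟨(hcont_gt t ht).continuousWithinAt, _,
        (hcont_gt t ht).continuousWithinAt⟩
  have hl_le : ∀ s ∈ Ioc 0 S, Function.leftLim q s = Function.leftLim r s := fun s hs =>
    hqcad.leftLim_congr hs.1 fun u hu => hq_lt u (hu.trans_le hs.2)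
  have hl_gt : ∀ s, S < s → Function.leftLim q s = flow H C ((s : ℝ) - S) Z := fun s hs => by
    rw [leftLim_eq_of_continuousAt (hcont_gt s hs), hq_ge s hs.le]
  refine ⟨fun t => ?_, hqcad, fun t => ?_, fun s hs => ?_⟩
  · rcases lt_or_ge t S with ht | ht
    · rw [hq_lt t ht]; exact h.state t
    · rw [hq_ge t ht]; exact hZ.flow H C _
  · rcases lt_or_ge t S with ht | ht
    · refine ((h.solves t).congr_path h.cadlag fun u hu => (hq_lt u (hu.trans_lt ht)).symm)
        |>.congr_measure ?_
      classical
      rw [Measure.restrict_add, restrict_dirac, if_neg, add_zero]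
      exact fun hc => absurd hc.1.2 (not_le.2 ht)
    · intro i j
      obtain ⟨h1, h2, h3⟩ := h.solves S i j
      obtain ⟨h4, h5⟩ := integral_drift_flow hH C hZ ht i j
      -- All points of ν precede S, so beyond S only the new point is added.
      have hA : (ν + Measure.dirac (S, c)).restrict (Ioc 0 t ×ˢ Ici 0)
          = ν.restrict (Ioc 0 S ×ˢ Ici 0) + Measure.dirac (S, c) := by
        classical
        rw [Measure.restrict_add, restrict_dirac, if_pos ⟨⟨hS, ht⟩, hc.le⟩]
        congr 1
        refine Measure.restrict_congr_set ?_
        filter_upwards [measure_eq_zero_iff_ae_notMem.1 hν] with p hp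
        have hp' : p.1 < S := (not_not.1 hp).1
        refine propext ⟨fun hx => ⟨⟨hx.1.1, hp'.le⟩, hx.2⟩, fun hx => ⟨⟨hx.1.1, hx.1.2.trans ht⟩, hx.2⟩⟩
      have hU : Ioc 0 t = Ioc 0 S ∪ Ioc S t := (Ioc_union_Ioc_eq_Ioc zero_le ht).symm
      have hdis : Disjoint (Ioc 0 S) (Ioc S t) := Ioc_disjoint_Ioc_of_le le_rfl
      have hmJ : MeasurableSet (Ioc 0 S ×ˢ Ici (0 : ℝ)) := measurableSet_Ioc.prod measurableSet_Ici
      have d1 : IntegrableOn (fun s => drift H C (Function.leftLim q s) i j) (Ioc 0 S)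
          timeMeasure := h1.congr_fun (fun s hs => by simp only [hl_le s hs]) measurableSet_Ioc
      have d2 : IntegrableOn (fun s => drift H C (Function.leftLim q s) i j) (Ioc S t)
          timeMeasure := h4.congr_fun (fun s hs => by simp only [hl_gt s hs.1]) measurableSet_Ioc
      have j1 : IntegrableOn (fun p : ℝ≥0 × ℝ => jumpCoeff C (Function.leftLim q p.1) p.2 i j)
          (Ioc 0 S ×ˢ Ici 0) ν := h2.congr_fun (fun p hp => by simp only [hl_le p.1 hp.1]) hmJ
      have j2 : Integrable (fun p : ℝ≥0 × ℝ => jumpCoeff C (Function.leftLim q p.1) p.2 i j)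
          (Measure.dirac (S, c)) := integrable_dirac (by simp)
      refine ⟨hU ▸ d1.union d2, ?_, ?_⟩
      · rw [IntegrableOn, hA]
        exact Integrable.add_measure j1 j2
      · rw [hA, integral_add_measure j1 j2, integral_dirac, hU, setIntegral_union hdis
          measurableSet_Ioc d1 d2,
          setIntegral_congr_fun (g := fun s => drift H C (Function.leftLim r s) i j)
            measurableSet_Ioc (fun s hs => by simp only [hl_le s hs]),
          setIntegral_congr_fun (s := Ioc S t)
            (g := fun u : ℝ≥0 => drift H C (flow H C ((u : ℝ) - S) Z) i j)
            measurableSet_Ioc (fun s hs => by simp only [hl_gt s hs.1]), h5,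
          setIntegral_congr_fun
            (g := fun p : ℝ≥0 × ℝ => jumpCoeff C (Function.leftLim r p.1) p.2 i j)
            hmJ (fun p hp => by simp only [hl_le p.1 hp.1]), hl_le S ⟨hS, le_rfl⟩,
          leftLim_eq_of_continuousAt hrS, hq_ge t ht]
        have hZe : Z i j = r S i j + jumpCoeff C (r S) c i j := by
          rw [hZdef, jump, Matrix.add_apply]
        linear_combination h3 + hZe
  · rw [Measure.add_apply, add_eq_zero] at hs
    rcases lt_trichotomy s S with ht | ht | ht
    · exact (h.continuousAt s hs.1).congr (hev_lt s ht).symm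
    · have h1 := hs.2
      rw [ht, Measure.dirac_apply' _ ((measurableSet_singleton _).prod .univ),
        indicator_of_mem (by simp)] at h1
      simp at h1
    · exact hcont_gt s ht

/-- The path driven by a configuration with at most `n` points, obtained by removing the last
points one by one. -/
noncomputable def configPath (H C ρ₀ : Mat) : ℕ → Measure (ℝ≥0 × ℝ) → ℝ≥0 → Mat
  | 0, _, t => flow H C t ρ₀
  | n + 1, ν, t =>
    -- The empty configuration has `lastTime` 0; the second alternative keeps it from receiving a
    -- spurious jump at time 0.
    if t < lastTime ν ∨ ν univ = 0 then configPath H C ρ₀ n (beforeLast ν) t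
    else flow H C ((t : ℝ) - lastTime ν)
      (jump C (configPath H C ρ₀ n (beforeLast ν) (lastTime ν)) (lastMark ν))

lemma isStatePath_configPath {H : Mat} (hH : H.IsHermitian) (C : Mat) {ρ₀ : Mat}
    (hρ₀ : IsState ρ₀) {T : ℝ≥0} {K : ℝ} (n : ℕ) :
    ∀ ν : Measure (ℝ≥0 × ℝ), IsConfig T K ν → ν univ ≤ n →
      IsStatePath H C ρ₀ ν (configPath H C ρ₀ n ν) := by
  induction n with
  | zero =>
    intro ν _ hn
    have : ν = 0 := Measure.measure_univ_eq_zero.1 (by simpa using hn)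
    subst this
    exact isStatePath_zero hH C hρ₀
  | succ n ih =>
    intro ν hν hn
    by_cases h0 : ν = 0
    · have hb : beforeLast ν = 0 := by simp [beforeLast, h0]
      have h1 := ih 0 (by simpa [beforeLast] using hν.restrict (B := ∅) .empty) (by simp)
      have h2 : configPath H C ρ₀ (n + 1) ν = configPath H C ρ₀ n 0 := by
        funext t
        rw [configPath, if_pos (by simp [h0]), hb]
      rw [h2, h0]
      exact h1
    · have hb : IsConfig T K (beforeLast ν) := hν.restrict (measurableSet_Iio.prod .univ)
      obtain ⟨hc, heq⟩ := hν.eq_add_dirac h0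
      have h1 := (ih _ hb (hν.measure_beforeLast_le h0 hn)).add_dirac hH (hν.lastTime_pos h0) hc (by
        rw [beforeLast, Measure.restrict_apply (measurableSet_Iio.prod .univ).compl,
          compl_inter_self, measure_empty])
      rw [← heq] at h1
      convert h1 using 1
      funext t
      rw [configPath]
      simp [h0]

/-! ### Measurability in the configuration. -/

/-- The second alternative is the empty infimum, whose value is 0. Integers suffice to detect it, so
the condition is countable. -/
lemma lastTime_le_iff (ν : Measure (ℝ≥0 × ℝ)) (a : ℝ≥0) :
    lastTime ν ≤ a ↔ ν (Ioi a ×ˢ univ) = 0 ∨ ∀ n : ℕ, ν (Ioi (n : ℝ≥0) ×ˢ univ) ≠ 0 := by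
  constructor
  · intro h
    by_cases hex : ∃ b, ν (Ioi b ×ˢ univ) = 0
    · refine Or.inl (measure_Ioi_prod_eq_zero fun c hc => ?_)
      obtain ⟨b, hb, hbc⟩ := exists_lt_of_csInf_lt (s := {a | ν (Ioi a ×ˢ univ) = 0}) hex
        (h.trans_lt hc)
      exact measure_mono_null (prod_mono (Ioi_subset_Ioi hbc.le) subset_rfl) hb
    · push Not at hex
      exact Or.inr fun n => hex n
  · rintro (h | h)
    · exact csInf_le (s := {a | ν (Ioi a ×ˢ univ) = 0}) (OrderBot.bddBelow _) h
    · have : {a | ν (Ioi a ×ˢ (univ : Set ℝ)) = 0} = ∅ := by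
        refine eq_empty_of_forall_notMem fun b hb => ?_
        obtain ⟨n, hn⟩ := exists_nat_ge b
        exact h n (measure_mono_null (prod_mono (Ioi_subset_Ioi hn) subset_rfl) hb)
      rw [lastTime, this, NNReal.sInf_empty]
      exact zero_le

lemma measurable_lastTime : Measurable lastTime := by
  refine measurable_of_Iic fun a => ?_
  have hm : ∀ b : ℝ≥0, Measurable fun ν : Measure (ℝ≥0 × ℝ) => ν (Ioi b ×ˢ univ) := fun b =>
    Measure.measurable_coe (measurableSet_Ioi.prod .univ)
  have : lastTime ⁻¹' Iic a = {ν | ν (Ioi a ×ˢ univ) = 0} ∪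
      ⋂ n : ℕ, {ν | ν (Ioi (n : ℝ≥0) ×ˢ univ) = 0}ᶜ := by
    ext ν
    simp only [mem_preimage, mem_Iic, lastTime_le_iff, mem_union, mem_ofPred_eq, mem_iInter,
      mem_compl_iff, ne_eq]
  rw [this]
  exact (hm a (measurableSet_singleton 0)).union
    (.iInter fun n => (hm n (measurableSet_singleton 0)).compl)

/-- The cut-off s will vary with ν. Exhausting by a dense sequence replaces the moving set by
countably many fixed ones. -/
lemma measure_inter_Iio_prod (ν : Measure (ℝ≥0 × ℝ)) (B : Set (ℝ≥0 × ℝ)) (s : ℝ≥0) :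
    ν (B ∩ Iio s ×ˢ univ) = ⨆ n : ℕ, if TopologicalSpace.denseSeq ℝ≥0 n < s then
      ν (B ∩ Iic (TopologicalSpace.denseSeq ℝ≥0 n) ×ˢ univ) else 0 := by
  set u := TopologicalSpace.denseSeq ℝ≥0
  set A : ℕ → Set (ℝ≥0 × ℝ) := fun n => if u n < s then B ∩ Iic (u n) ×ˢ univ else ∅ with hA
  have hU : B ∩ Iio s ×ˢ univ = ⋃ n, A n := by
    ext p
    simp only [mem_inter_iff, mem_prod, mem_Iio, mem_univ, and_true, mem_iUnion, hA]
    constructor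
    · rintro ⟨hB, hp⟩
      obtain ⟨_, ⟨n, rfl⟩, hn⟩ := (TopologicalSpace.denseRange_denseSeq ℝ≥0).exists_between hp
      exact ⟨n, by rw [if_pos hn.2]; exact ⟨hB, hn.1.le, trivial⟩⟩
    · rintro ⟨n, hn⟩
      split_ifs at hn with h
      · exact ⟨hn.1, lt_of_le_of_lt hn.2.1 h⟩
      · exact hn.elim
  have hdir : Directed (· ⊆ ·) A := by
    have key : ∀ m n, u m ≤ u n → u n < s → A m ⊆ A n ∧ A n ⊆ A n := by
      intro m n hmn hn
      refine ⟨?_, subset_rfl⟩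
      simp only [hA, if_pos hn, if_pos (hmn.trans_lt hn)]
      exact inter_subset_inter_right _ (prod_mono (Iic_subset_Iic.2 hmn) subset_rfl)
    intro m n
    by_cases hm : u m < s
    · by_cases hn : u n < s
      · rcases le_total (u m) (u n) with h | h
        · exact ⟨n, (key m n h hn).1, subset_rfl⟩
        · exact ⟨m, subset_rfl, (key n m h hm).1⟩
      · exact ⟨m, subset_rfl, by simp [hA, hn]⟩
    · exact ⟨n, by simp [hA, hm], subset_rfl⟩
  rw [hU, hdir.measure_iUnion]
  refine iSup_congr fun n => ?_
  simp only [hA]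
  split_ifs <;> simp

lemma measurable_beforeLast : Measurable beforeLast := by
  refine Measure.measurable_of_measurable_coe _ fun B hB => ?_
  have : (fun ν : Measure (ℝ≥0 × ℝ) => beforeLast ν B) = fun ν => ⨆ n : ℕ,
      if TopologicalSpace.denseSeq ℝ≥0 n < lastTime ν then
      ν (B ∩ Iic (TopologicalSpace.denseSeq ℝ≥0 n) ×ˢ univ) else 0 := by
    funext ν
    rw [beforeLast, Measure.restrict_apply hB, measure_inter_Iio_prod]
  rw [this]
  refine .iSup fun n => .ite (measurableSet_lt measurable_const measurable_lastTime) ?_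
    measurable_const
  exact Measure.measurable_coe (hB.inter (measurableSet_Iic.prod .univ))

lemma measurable_lastMark : Measurable lastMark := by
  have h : Measurable fun ν : Measure (ℝ≥0 × ℝ) => ∫⁻ p, ENNReal.ofReal p.2 ∂ν :=
    Measure.measurable_lintegral (by fun_prop)
  exact h.ennreal_toReal.sub (h.comp measurable_beforeLast).ennreal_toReal

section StronglyMeasurable

variable {α : Type*} [MeasurableSpace α]

section

open scoped Matrix.Norms.Operator

lemma continuous_exp_effGen (H C : Mat) :
    Continuous fun u : ℝ => NormedSpace.exp (u • effGen H C) :=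
  continuous_iff_continuousAt.2 fun a => (hasDerivAt_exp_smul_const (effGen H C) a).continuousAt

end

lemma stronglyMeasurable_trace {Z : α → Mat} (hZ : StronglyMeasurable Z) :
    StronglyMeasurable fun a => (Z a).trace :=
  (continuous_id.matrix_trace).comp_stronglyMeasurable hZ

lemma stronglyMeasurable_flow (H C : Mat) {f : α → ℝ} (hf : Measurable f) {Z : α → Mat}
    (hZ : StronglyMeasurable Z) : StronglyMeasurable fun a => flow H C (f a) (Z a) := by
  have he : StronglyMeasurable fun a => NormedSpace.exp (f a • effGen H C) :=
    (continuous_exp_effGen H C).comp_stronglyMeasurable hf.stronglyMeasurable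
  have hl : StronglyMeasurable fun a => linFlow H C (f a) (Z a) :=
    (he.mul hZ).mul ((continuous_id.matrix_conjTranspose).comp_stronglyMeasurable he)
  exact ((stronglyMeasurable_trace hl).measurable.inv.stronglyMeasurable).smul hl

lemma stronglyMeasurable_jump (C : Mat) {x : α → ℝ} (hx : Measurable x) {Z : α → Mat}
    (hZ : StronglyMeasurable Z) : StronglyMeasurable fun a => jump C (Z a) (x a) := by
  classical
  have hJ : StronglyMeasurable fun a => jumpOp C (Z a) :=
    (stronglyMeasurable_const.mul hZ).mul stronglyMeasurable_const
  have htr := stronglyMeasurable_trace hJ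
  have hset : MeasurableSet {a | inJumpRegion C (Z a) (x a)} :=
    (measurableSet_le measurable_const hx).inter
      (measurableSet_le hx (Complex.measurable_re.comp htr.measurable))
  refine hZ.add ?_
  have : (fun a => jumpCoeff C (Z a) (x a)) = fun a => if inJumpRegion C (Z a) (x a) then
      ((jumpOp C (Z a)).trace)⁻¹ • jumpOp C (Z a) - Z a else 0 := by
    funext a
    rw [jumpCoeff, indicator_apply]
    rfl
  rw [this]
  exact .ite hset (((htr.measurable.inv.stronglyMeasurable).smul hJ).sub hZ)
    stronglyMeasurable_const

end StronglyMeasurable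

lemma stronglyMeasurable_configPath (H C ρ₀ : Mat) (n : ℕ) :
    StronglyMeasurable fun p : Measure (ℝ≥0 × ℝ) × ℝ≥0 => configPath H C ρ₀ n p.1 p.2 := by
  induction n with
  | zero => exact stronglyMeasurable_flow H C (by fun_prop) stronglyMeasurable_const
  | succ n ih =>
    have hb : Measurable fun p : Measure (ℝ≥0 × ℝ) × ℝ≥0 => beforeLast p.1 :=
      measurable_beforeLast.comp measurable_fst
    have ht : Measurable fun p : Measure (ℝ≥0 × ℝ) × ℝ≥0 => lastTime p.1 :=
      measurable_lastTime.comp measurable_fst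
    have hx : Measurable fun p : Measure (ℝ≥0 × ℝ) × ℝ≥0 => lastMark p.1 :=
      measurable_lastMark.comp measurable_fst
    have hu : Measurable fun p : Measure (ℝ≥0 × ℝ) × ℝ≥0 => p.1 univ :=
      (Measure.measurable_coe .univ).comp measurable_fst
    simp only [configPath]
    refine .ite ?_ (ih.comp_measurable (hb.prodMk measurable_snd)) ?_
    · exact (measurableSet_lt measurable_snd ht).union (hu (measurableSet_singleton 0))
    · refine stronglyMeasurable_flow H C ?_ (stronglyMeasurable_jump C hx
        (ih.comp_measurable (hb.prodMk ht)))
      exact measurable_snd.coe_nnreal_real.sub ht.coe_nnreal_real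

/-- The path driven by a finite configuration. -/
noncomputable def solutionPath (H C ρ₀ : Mat) (ν : Measure (ℝ≥0 × ℝ)) : ℝ≥0 → Mat :=
  configPath H C ρ₀ ⌊(ν univ).toReal⌋₊ ν

section

open scoped Matrix.Norms.Operator

lemma stronglyMeasurable_solutionPath (H C ρ₀ : Mat) (t : ℝ≥0) :
    StronglyMeasurable fun ν => solutionPath H C ρ₀ ν t := by
  have : SecondCountableTopology Mat :=
    inferInstanceAs (SecondCountableTopology (Fin 2 → Fin 2 → ℂ))
  borelize Mat
  refine stronglyMeasurable_iff_measurable.2 ?_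
  have h : Measurable fun p : ℕ × Measure (ℝ≥0 × ℝ) => configPath H C ρ₀ p.1 p.2 t :=
    measurable_from_prod_countable_right fun n =>
      ((stronglyMeasurable_configPath H C ρ₀ n).comp_measurable
        (measurable_id.prodMk measurable_const)).measurable
  have hN : Measurable fun ν : Measure (ℝ≥0 × ℝ) => ⌊(ν univ).toReal⌋₊ :=
    Nat.measurable_floor.comp (Measure.measurable_coe .univ).ennreal_toReal
  exact h.comp (hN.prodMk measurable_id)

end

lemma IsConfig.isStatePath {H : Mat} (hH : H.IsHermitian) (C : Mat) {ρ₀ : Mat}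
    (hρ₀ : IsState ρ₀) {T : ℝ≥0} {K : ℝ} {ν : Measure (ℝ≥0 × ℝ)} (h : IsConfig T K ν) :
    IsStatePath H C ρ₀ ν (solutionPath H C ρ₀ ν) := by
  refine isStatePath_configPath hH C hρ₀ _ ν h ?_
  obtain ⟨n, hn⟩ := h.integer univ .univ
  have hfin := h.finite
  rw [hn] at hfin ⊢
  cases n with
  | top => simp at hfin
  | coe n => simp

/-- For infinite mass `toReal` gives 0, so the path is the plain flow. The values are thus states on
every configuration, including exceptional ones. -/
lemma isState_solutionPath {H : Mat} (hH : H.IsHermitian) (C : Mat) {ρ₀ : Mat}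
    (hρ₀ : IsState ρ₀) {T : ℝ≥0} {K : ℝ} {ν : Measure (ℝ≥0 × ℝ)}
    (h : ν univ ≠ ∞ → IsConfig T K ν) (t : ℝ≥0) : IsState (solutionPath H C ρ₀ ν t) := by
  by_cases hfin : ν univ = ∞
  · have : solutionPath H C ρ₀ ν t = flow H C t ρ₀ := by simp [solutionPath, hfin, configPath]
    rw [this]
    exact hρ₀.flow H C t
  · exact ((h hfin).isStatePath hH C hρ₀).state t

/-! ### From finite configurations to the driving measure. -/

/-- The points with time in `(0, t]` and mark in `(0, K]`. -/
noncomputable def boxed (K : ℝ) (ν : Measure (ℝ≥0 × ℝ)) (t : ℝ≥0) : Measure (ℝ≥0 × ℝ) :=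
  ν.restrict (Ioc 0 t ×ˢ Ioc 0 K)

lemma measurableSet_box (K : ℝ) (t : ℝ≥0) :
    MeasurableSet ((Ioc 0 t : Set ℝ≥0) ×ˢ (Ioc 0 K : Set ℝ)) :=
  measurableSet_Ioc.prod measurableSet_Ioc

lemma boxed_restrict (K : ℝ) (ν : Measure (ℝ≥0 × ℝ)) {s t : ℝ≥0} (hst : s ≤ t) :
    (boxed K ν t).restrict (Ioc 0 s ×ˢ Ici 0) = ν.restrict (Ioc 0 s ×ˢ Ioc 0 K) := by
  rw [boxed, Measure.restrict_restrict (measurableSet_Ioc.prod measurableSet_Ici)]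
  congr 1
  ext p
  simp only [mem_inter_iff, mem_prod, mem_Ioc, mem_Ici]
  exact ⟨fun h => ⟨h.1.1, h.2.2⟩,
    fun h => ⟨⟨h.1, h.2.1.le⟩, ⟨h.1.1, h.1.2.trans hst⟩, h.2⟩⟩

lemma isConfig_boxed {K : ℝ} {ν : Measure (ℝ≥0 × ℝ)} {t : ℝ≥0}
    (hs : ∀ t : ℝ≥0, ν ({t} ×ˢ univ) ≤ 1)
    (hi : ∀ A : Set (ℝ≥0 × ℝ), MeasurableSet A → ∃ n : ℕ∞, ν A = (n : ℝ≥0∞))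
    (hfin : boxed K ν t univ ≠ ∞) : IsConfig t K (boxed K ν t) where
  slice s := (Measure.restrict_apply_le _ _).trans (hs s)
  integer A hA := by
    rw [boxed, Measure.restrict_apply hA]; exact hi _ (hA.inter (measurableSet_box K t))
  support := by
    rw [boxed, Measure.restrict_apply (measurableSet_box K t).compl, compl_inter_self,
      measure_empty]
  finite := hfin

lemma IsCadlag.jump_rate_leftLim_le {C : Mat} {r : ℝ≥0 → Mat} (hr : IsCadlag r) {K : ℝ}
    (hK : ∀ u, ((jumpOp C (r u)).trace).re ≤ K) {s : ℝ≥0} (hs : 0 < s) :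
    ((jumpOp C (Function.leftLim r s)).trace).re ≤ K := by
  have := nhdsLT_neBot_of_pos hs
  exact le_of_tendsto' (((continuous_trace_jumpOp C).tendsto _).comp (hr.tendsto_leftLim s))
    fun u => hK u

/-- Marks outside `(0, K]` do not contribute when the jump rate is bounded by `K`. -/
lemma SolvesAt.of_boxed {H C ρ₀ : Mat} {ν : Measure (ℝ≥0 × ℝ)} {r : ℝ≥0 → Mat} {K : ℝ} {t : ℝ≥0}
    (h : SolvesAt H C ρ₀ (boxed K ν t) r t) (hr : IsCadlag r)
    (hK : ∀ u, ((jumpOp C (r u)).trace).re ≤ K) (h0 : ν (univ ×ˢ {0}) = 0) :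
    SolvesAt H C ρ₀ ν r t := by
  intro i j
  obtain ⟨h1, h2, h3⟩ := h i j
  rw [IntegrableOn, boxed_restrict K ν le_rfl] at h2
  rw [boxed_restrict K ν le_rfl] at h3
  have hm : NullMeasurableSet (Ioc 0 t ×ˢ Ici (0 : ℝ)) ν :=
    (measurableSet_Ioc.prod measurableSet_Ici).nullMeasurableSet
  -- Discarded points have mark zero, a null set, or mark above K, beyond the jump rate.
  have hz : ∀ᵐ p ∂ν, p ∈ (Ioc 0 t ×ˢ Ici (0 : ℝ)) \ (Ioc 0 t ×ˢ Ioc 0 K) →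
      jumpCoeff C (Function.leftLim r p.1) p.2 i j = 0 := by
    filter_upwards [measure_eq_zero_iff_ae_notMem.1 h0] with p hp hp'
    have hne : p.2 ≠ 0 := fun hc => hp ⟨trivial, hc⟩
    have : ¬ inJumpRegion C (Function.leftLim r p.1) p.2 := fun hj =>
      hp'.2 ⟨hp'.1.1, lt_of_le_of_ne hj.1 hne.symm,
        hj.2.trans (hr.jump_rate_leftLim_le hK hp'.1.1.1)⟩
    simp only [jumpCoeff]
    rw [indicator_of_notMem (by exact this)]
    rfl
  refine ⟨h1, IntegrableOn.of_ae_sdiff_eq_zero h2 hm hz, ?_⟩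
  rw [setIntegral_eq_of_subset_of_ae_sdiff_eq_zero hm
    (prod_mono subset_rfl fun x hx => le_of_lt hx.1) hz]
  exact h3

/-- The solution of the equation driven by `ν`, computed at each time from the finitely many
points that matter up to that time. -/
noncomputable def solution (H C ρ₀ : Mat) (K : ℝ) (ν : Measure (ℝ≥0 × ℝ)) (t : ℝ≥0) : Mat :=
  solutionPath H C ρ₀ (boxed K ν t) t

section Pathwise

variable {H C ρ₀ : Mat} {K : ℝ} {ν : Measure (ℝ≥0 × ℝ)}

/-- Both paths solve, up to time t, the equation of the configuration cut at t, so uniqueness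
identifies them. Cutting at the current time is what makes the solution adapted. -/
lemma solution_eq_solutionPath (hH : H.IsHermitian) (hρ₀ : IsState ρ₀)
    (hs : ∀ t : ℝ≥0, ν ({t} ×ˢ univ) ≤ 1)
    (hi : ∀ A : Set (ℝ≥0 × ℝ), MeasurableSet A → ∃ n : ℕ∞, ν A = (n : ℝ≥0∞))
    (hfin : ∀ t : ℝ≥0, boxed K ν t univ ≠ ∞) {t T : ℝ≥0} (htT : t ≤ T) :
    solution H C ρ₀ K ν t = solutionPath H C ρ₀ (boxed K ν T) t := by
  have ct := isConfig_boxed hs hi (hfin t)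
  have h1 := ct.isStatePath hH C hρ₀
  have h2 := (isConfig_boxed hs hi (hfin T)).isStatePath hH C hρ₀
  refine eq_of_solvesAt ct.integer
    (fun k => ne_top_of_le_ne_top ct.finite (measure_mono (subset_univ _)))
    h1.cadlag h2.cadlag (fun s _ => h1.solves s) (fun s hst => ?_) t le_rfl
  refine (h2.solves s).congr_measure ?_
  rw [boxed_restrict K ν (hst.trans htT), boxed_restrict K ν hst]

lemma solution_isCadlag (hH : H.IsHermitian) (hρ₀ : IsState ρ₀)
    (hs : ∀ t : ℝ≥0, ν ({t} ×ˢ univ) ≤ 1)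
    (hi : ∀ A : Set (ℝ≥0 × ℝ), MeasurableSet A → ∃ n : ℕ∞, ν A = (n : ℝ≥0∞))
    (hfin : ∀ t : ℝ≥0, boxed K ν t univ ≠ ∞) : IsCadlag (solution H C ρ₀ K ν) := by
  intro t
  have h2 := ((isConfig_boxed hs hi (hfin (t + 1))).isStatePath hH C hρ₀).cadlag t
  have hev : solution H C ρ₀ K ν =ᶠ[𝓝 t] solutionPath H C ρ₀ (boxed K ν (t + 1)) := by
    filter_upwards [gt_mem_nhds (lt_add_of_pos_right t zero_lt_one)] with u hu
    exact solution_eq_solutionPath hH hρ₀ hs hi hfin hu.le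
  obtain ⟨l, hl⟩ := h2.2
  exact ⟨h2.1.congr_of_eventuallyEq (hev.filter_mono nhdsWithin_le_nhds) hev.self_of_nhds,
    l, hl.congr' (hev.filter_mono nhdsWithin_le_nhds).symm⟩

lemma solution_solvesPath (hH : H.IsHermitian) (hρ₀ : IsState ρ₀)
    (hK : ∀ ρ, IsState ρ → ((jumpOp C ρ).trace).re ≤ K)
    (hs : ∀ t : ℝ≥0, ν ({t} ×ˢ univ) ≤ 1)
    (hi : ∀ A : Set (ℝ≥0 × ℝ), MeasurableSet A → ∃ n : ℕ∞, ν A = (n : ℝ≥0∞))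
    (hfin : ∀ t : ℝ≥0, boxed K ν t univ ≠ ∞) (h0 : ν (univ ×ˢ {0}) = 0) :
    SolvesPath H C ρ₀ ν (solution H C ρ₀ K ν) := by
  intro t
  have h := (isConfig_boxed hs hi (hfin t)).isStatePath hH C hρ₀
  exact ((h.solves t).of_boxed h.cadlag (fun u => hK _ (h.state u)) h0).congr_path h.cadlag
    fun u hu => (solution_eq_solutionPath hH hρ₀ hs hi hfin hu).symm

end Pathwise

lemma ae_finite_on_boxes {Ω : Type*} [MeasurableSpace Ω] {P : Measure Ω}
    {μ : Kernel Ω (ℝ≥0 × ℝ)}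
    (hint : ∀ A : Set (ℝ≥0 × ℝ), MeasurableSet A →
      ∫⁻ ω, μ ω A ∂P = (timeMeasure.prod (volume : Measure ℝ)) A) :
    ∀ᵐ ω ∂P, ∀ (t : ℝ≥0) (k : ℝ), μ ω (Ioc 0 t ×ˢ Icc 0 k) ≠ ∞ := by
  have h : ∀ n : ℕ, ∀ᵐ ω ∂P, μ ω (Ioc 0 (n : ℝ≥0) ×ˢ Icc (0 : ℝ) n) < ∞ := by
    intro n
    have hm : MeasurableSet (Ioc 0 (n : ℝ≥0) ×ˢ Icc (0 : ℝ) n) :=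
      measurableSet_Ioc.prod measurableSet_Icc
    refine ae_lt_top (μ.measurable_coe hm) ?_
    rw [hint _ hm, Measure.prod_prod, timeMeasure_Ioc, Real.volume_Icc]
    exact ENNReal.mul_ne_top ENNReal.ofReal_ne_top ENNReal.ofReal_ne_top
  filter_upwards [ae_all_iff.2 h] with ω hω t k
  obtain ⟨m, hm⟩ := exists_nat_ge t
  obtain ⟨n, hn⟩ := exists_nat_ge k
  have h1 : t ≤ (max m n : ℕ) := hm.trans (by exact_mod_cast le_max_left m n)
  have h2 : k ≤ (max m n : ℕ) := hn.trans (by exact_mod_cast le_max_right m n)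
  exact ne_top_of_le_ne_top (hω (max m n)).ne
    (measure_mono (prod_mono (Ioc_subset_Ioc_right h1) (Icc_subset_Icc_right h2)))

/-- The σ-algebra is arbitrary, so the lemma serves both the full one and `𝓕 t`. -/
lemma stronglyMeasurable_solution {Ω : Type*} [MeasurableSpace Ω] (H C ρ₀ : Mat) (K : ℝ)
    {μ : Ω → Measure (ℝ≥0 × ℝ)} (t : ℝ≥0)
    (hμ : ∀ A : Set (ℝ≥0 × ℝ), MeasurableSet A → A ⊆ Iic t ×ˢ univ →
      Measurable fun ω => μ ω A) :
    StronglyMeasurable fun ω => solution H C ρ₀ K (μ ω) t := by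
  refine (stronglyMeasurable_solutionPath H C ρ₀ t).comp_measurable
    (Measure.measurable_of_measurable_coe _ fun A hA => ?_)
  simp only [boxed, Measure.restrict_apply hA]
  exact hμ _ (hA.inter (measurableSet_box K t)) fun p hp => ⟨hp.2.1.2, trivial⟩

end JumpBelavkin

theorem theorem4 {Ω : Type*} [mΩ : MeasurableSpace Ω]
    (P : Measure Ω) [IsProbabilityMeasure P] (𝓕 : Filtration ℝ≥0 mΩ)
    (μ : Kernel Ω (ℝ≥0 × ℝ))
    (hμ : JumpBelavkin.IsPoissonRandomMeasure 𝓕 P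
      (JumpBelavkin.timeMeasure.prod (volume : Measure ℝ)) μ)
    (H C : JumpBelavkin.Mat) (hH : H.IsHermitian)
    (ρ₀ : JumpBelavkin.Mat) (hρ₀ : JumpBelavkin.IsState ρ₀) :
    ∃ ρ : ℝ≥0 → Ω → JumpBelavkin.Mat,
      JumpBelavkin.IsSolution P μ H C ρ₀ ρ ∧
      (∀ t ω, JumpBelavkin.IsState (ρ t ω)) ∧
      (∀ᵐ ω ∂P, ∀ t, JumpBelavkin.jumpCount C (μ ω) (fun s => ρ s ω) t < ∞) ∧
      (JumpBelavkin.IsAdaptedMeasure 𝓕 μ → StronglyAdapted 𝓕 ρ) ∧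
      ∀ ρ' : ℝ≥0 → Ω → JumpBelavkin.Mat, JumpBelavkin.IsSolution P μ H C ρ₀ ρ' →
        ∀ᵐ ω ∂P, ∀ t, ρ' t ω = ρ t ω := by
  open JumpBelavkin in
  obtain ⟨K, hK⟩ := exists_jump_rate_bound C
  have hs := fun ω => hμ.integerValued.slice_le_one ω
  have hi := fun ω => hμ.integerValued.integer ω
  have hstate : ∀ t ω, IsState (solution H C ρ₀ K (μ ω) t) := fun t ω =>
    isState_solutionPath hH C hρ₀ (isConfig_boxed (hs ω) (hi ω)) t
  have hfin := ae_finite_on_boxes hμ.intensity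
  have hbox : ∀ᵐ ω ∂P, ∀ t : ℝ≥0, boxed K (μ ω) t univ ≠ ∞ := by
    filter_upwards [hfin] with ω hω t
    rw [boxed, Measure.restrict_apply_univ]
    exact ne_top_of_le_ne_top (hω t K) (measure_mono (prod_mono subset_rfl Ioc_subset_Icc_self))
  -- The line of marks zero has intensity 0, so its expected mass vanishes.
  have hzero : ∀ᵐ ω ∂P, μ ω (univ ×ˢ {0}) = 0 := by
    have hm : MeasurableSet ((univ : Set ℝ≥0) ×ˢ ({0} : Set ℝ)) :=
      MeasurableSet.univ.prod (measurableSet_singleton 0)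
    have h := hμ.intensity _ hm
    rw [Measure.prod_prod, Real.volume_singleton, mul_zero] at h
    exact (lintegral_eq_zero_iff (μ.measurable_coe hm)).1 h
  have hcad : ∀ᵐ ω ∂P, IsCadlag fun t => solution H C ρ₀ K (μ ω) t := by
    filter_upwards [hbox] with ω hω using solution_isCadlag hH hρ₀ (hs ω) (hi ω) hω
  have heq : ∀ᵐ ω ∂P, SolvesPath H C ρ₀ (μ ω) fun t => solution H C ρ₀ K (μ ω) t := by
    filter_upwards [hbox, hzero] with ω hω h0
    exact solution_solvesPath hH hρ₀ hK (hs ω) (hi ω) hω h0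
  refine ⟨fun t ω => solution H C ρ₀ K (μ ω) t, ⟨fun t => ?_, hcad, heq⟩, hstate, ?_, ?_, ?_⟩
  · exact stronglyMeasurable_solution H C ρ₀ K t fun A hA _ => μ.measurable_coe hA
  · filter_upwards [hfin, hcad] with ω hω hc t
    refine lt_of_le_of_lt (measure_mono ?_) (hω t K).lt_top
    intro p hp
    -- Left limits of states inherit the bound K, so all counted points lie in a box of finite mass.
    exact ⟨hp.1, hp.2.1, hp.2.2.trans
      (hc.jump_rate_leftLim_le (fun u => hK _ (hstate u ω)) hp.1.1)⟩
  · intro had t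
    exact @stronglyMeasurable_solution Ω (𝓕 t) H C ρ₀ K (fun ω => μ ω) t (had t)
  · intro ρ' hρ'
    filter_upwards [hfin, hcad, heq, hρ'.cadlag, hρ'.equation] with ω hω hc he hc' he' t
    exact eq_of_solvesAt (hi ω) (hω t) hc' hc (fun s _ => he' s) (fun s _ => he s) t le_rfl
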